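/- All Hilbert spaces are finite-dimensional. A system consists of a density matrix $\rho_{\rm in}$ on $A\bar A$ (a region $A$ at the initial time and its complement) and an evolution $\mathcal E$ from $A\bar A$ to $B\bar B$ (a region $B$ at the final time and its complement); $\mathcal E$ may be any quantum channel (completely positive trace-preserving map), for example $X\mapsto UXU^\dagger$ with $U$ unitary. Let $S(\rho|\sigma)=\mathrm{tr}(\rho\log\rho-\rho\log\sigma)$ be the relative entropy, equal to $+\infty$ if $\mathrm{supp}\,\rho\not\subseteq\mathrm{supp}\,\sigma$. For $N\ge 1$ set $$J_N(A:B)=\frac1N\sup S\big(\rho_{B^NW}\,\big|\,\rho_{B,0}^{\otimes N}\otimes\rho_W\big),\qquad J(A:B)=\lim_{N\to\infty}J_N(A:B),$$ where the supremum is over all finite-dimensional ancillas $W$, all pure states $|\psi\rangle$ of $W$ and all unitaries $V$ on $A^NW$; here $$\rho_{B^NW}=\mathrm{tr}_{\bar B^N}\,\mathcal E^{\otimes N}\big(V(\rho_{\rm in}^{\otimes N}\otimes|\psi\rangle\langle\psi|)V^\dagger\big)$$ is the state obtained from $N$ copies of the system coupled to $W$ at $A$, $\rho_W=\mathrm{tr}_{B^N}\rho_{B^NW}$,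 and $\rho_{B,0}=\mathrm{tr}_{\bar B}\,\mathcal E(\rho_{\rm in})$ is the unperturbed evolved state on $B$. The value $+\infty$ is allowed. Applying a channel $\mathcal N_B$ from $B$ to $B'$ to the region $B$ means replacing $\mathcal E$ by $(\mathcal N_B\otimes\mathrm{id}_{\bar B})\circ\mathcal E$ (so that $\rho_{B,0}$ becomes $\mathcal N_B(\rho_{B,0})$). Applying a channel $\mathcal N_A$ from $A$ to $A$ to the region $A$ means that in each of the $N$ copies coupled to $W$ the channel acts on $A$ right before $V$, that is, $\rho_{\rm in}$ is replaced by $(\mathcal N_A\otimes\mathrm{id}_{\bar A})(\rho_{\rm in})$ in the definition of $\rho_{B^NW}$ and $\rho_W$, while $\rho_{B,0}=\mathrm{tr}_{\bar B}\,\mathcal E(\rho_{\rm in})$ remains the state of the unperturbed system. Then the limits defining $J(A:B)$, before and after a channel is applied, exist in the extended reals, and the space-time mutual information is monotone: 1. For every channel $\mathcal N_B$, neither $J_N(A:B)$ (for any $N\ge1$) nor $J(A:B)$ increases when $\mathcal N_B$ is applied to $B$. 2. For every channel $\mathcal N_A$, neither $J_N(A:B)$ (for any $N\ge1$) nor $J(A:B)$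 increases when $\mathcal N_A$ is applied to $A$. 3. For disjoint regions $A,C$ at the initial time, $J_N(A:B)\le J_N(AC:B)$ for all $N\ge1$, and $J(A:B)\le J(AC:B)$. 4. For disjoint regions $B,D$ at the final time, $J_N(A:B)\le J_N(A:BD)$ for all $N\ge1$, and $J(A:B)\le J(A:BD)$. -/

import Mathlib

open Filter Topology
open scoped Matrix Kronecker ComplexOrder

universe u

noncomputable section

namespace STMI

/-- Density matrices on the Hilbert space with orthonormal basis `X`. -/
def IsState {X : Type*} [Fintype X] (ρ : Matrix X X ℂ) : Prop :=
  ρ.PosSemidef ∧ ρ.trace = 1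

/-- The map `Φ ⊗ id_Z`. -/
def ampliate {X Y : Type*} (Φ : Matrix X X ℂ →ₗ[ℂ] Matrix Y Y ℂ) (Z : Type*) :
    Matrix (X × Z) (X × Z) ℂ →ₗ[ℂ] Matrix (Y × Z) (Y × Z) ℂ where
  toFun M := Matrix.of fun p q =>
    Φ (Matrix.of fun x x' => M (x, p.2) (x', q.2)) p.1 q.1
  map_add' M M' := by
    ext p q
    exact congrFun (congrFun (Φ.map_add (Matrix.of fun x x' => M (x, p.2) (x', q.2))
      (Matrix.of fun x x' => M' (x, p.2) (x', q.2))) p.1) q.1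
  map_smul' c M := by
    ext p q
    exact congrFun (congrFun (Φ.map_smul c
      (Matrix.of fun x x' => M (x, p.2) (x', q.2))) p.1) q.1

/-- Quantum channels: completely positive trace-preserving linear maps. -/
def IsChannel {X Y : Type*} [Fintype X] [Fintype Y]
    (Φ : Matrix X X ℂ →ₗ[ℂ] Matrix Y Y ℂ) : Prop :=
  (∀ (n : ℕ) (M : Matrix (X × Fin n) (X × Fin n) ℂ),
      M.PosSemidef → (ampliate Φ (Fin n) M).PosSemidef) ∧
    ∀ M : Matrix X X ℂ, (Φ M).trace = M.trace

/-- Partial trace over the second tensor factor. -/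
def traceSnd (X Z : Type*) [Fintype Z] :
    Matrix (X × Z) (X × Z) ℂ →ₗ[ℂ] Matrix X X ℂ where
  toFun M := Matrix.of fun x x' => ∑ z, M (x, z) (x', z)
  map_add' M M' := by
    ext x x'
    simp [Finset.sum_add_distrib]
  map_smul' c M := by
    ext x x'
    simp [Finset.mul_sum]

/-- Partial trace over the first tensor factor. -/
def traceFst {X Z : Type*} [Fintype X] (M : Matrix (X × Z) (X × Z) ℂ) : Matrix Z Z ℂ :=
  Matrix.of fun z z' => ∑ x, M (x, z) (x, z')

/-- `M^{⊗ N}`; the `N`-fold tensor power of the space with basis `X` has basis `Fin N → X`. -/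
def tensorPow {X : Type*} (N : ℕ) (M : Matrix X X ℂ) :
    Matrix (Fin N → X) (Fin N → X) ℂ :=
  Matrix.of fun i j => ∏ t, M (i t) (j t)

/-- `Φ^{⊗ N}`: the linear map sending each matrix unit `E_{k₁l₁} ⊗ ⋯ ⊗ E_{k_Nl_N}` to
`Φ E_{k₁l₁} ⊗ ⋯ ⊗ Φ E_{k_Nl_N}`. -/
def mapPow {X Y : Type*} [Fintype X] [DecidableEq X] (N : ℕ)
    (Φ : Matrix X X ℂ →ₗ[ℂ] Matrix Y Y ℂ) :
    Matrix (Fin N → X) (Fin N → X) ℂ →ₗ[ℂ] Matrix (Fin N → Y) (Fin N → Y) ℂ where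
  toFun M := Matrix.of fun i j =>
    ∑ k, ∑ l, M k l * ∏ t, Φ (Matrix.single (k t) (l t) 1) (i t) (j t)
  map_add' M M' := by
    ext i j
    simp [add_mul, Finset.sum_add_distrib]
  map_smul' c M := by
    ext i j
    simp [Finset.mul_sum, mul_assoc]

/-- Quantum relative entropy `S(ρ|σ) = tr (ρ log ρ - ρ log σ)`, equal to `+∞` if the support of
`ρ` is not contained in that of `σ`. (Since `Real.log 0 = 0`, the logarithms vanish on the
kernels, which realizes the convention `0 log 0 = 0`.) -/
def relEntropy {X : Type*} [Fintype X] [DecidableEq X] (ρ σ : Matrix X X ℂ) : EReal :=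
  open Classical in
  if ∀ v : X → ℂ, σ *ᵥ v = 0 → ρ *ᵥ v = 0 then
    ((ρ * (cfc Real.log ρ - cfc Real.log σ)).trace.re : EReal)
  else ⊤

section Definition

variable {A Abar B Bbar W : Type*}
  [Fintype A] [DecidableEq A] [Fintype Abar] [DecidableEq Abar]
  [Fintype B] [DecidableEq B] [Fintype Bbar] [DecidableEq Bbar]
  [Fintype W] [DecidableEq W]

/-- An operator `V` on `A^N W`, regarded as the operator `V ⊗ 1` on `(A Abar)^N W`. -/
def extendCoupling (Abar : Type*) [Fintype Abar] [DecidableEq Abar] {N : ℕ}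
    (V : Matrix ((Fin N → A) × W) ((Fin N → A) × W) ℂ) :
    Matrix ((Fin N → A × Abar) × W) ((Fin N → A × Abar) × W) ℂ :=
  Matrix.of fun p q =>
    V (fun t => (p.1 t).1, p.2) (fun t => (q.1 t).1, q.2) *
      if (fun t => (p.1 t).2) = (fun t => (q.1 t).2) then 1 else 0

/-- `V (ρ^{⊗ N} ⊗ |ψ⟩⟨ψ|) V†`: the state of `(A Abar)^N W` after the coupling `V` between
`A^N` and the ancilla `W`, initially in the pure state `ψ`. -/
def coupledState (N : ℕ) (ρ : Matrix (A × Abar) (A × Abar) ℂ) (ψ : W → ℂ)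
    (V : Matrix ((Fin N → A) × W) ((Fin N → A) × W) ℂ) :
    Matrix ((Fin N → A × Abar) × W) ((Fin N → A × Abar) × W) ℂ :=
  extendCoupling Abar V * (tensorPow N ρ ⊗ₖ Matrix.vecMulVec ψ (star ψ)) *
    (extendCoupling Abar V)ᴴ

/-- The evolution `𝓔` of the whole system, followed by the partial trace over the complement
`Bbar` of the final region `B`. -/
def evolveTo (𝓔 : Matrix (A × Abar) (A × Abar) ℂ →ₗ[ℂ] Matrix (B × Bbar) (B × Bbar) ℂ) :
    Matrix (A × Abar) (A × Abar) ℂ →ₗ[ℂ] Matrix B B ℂ :=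
  traceSnd B Bbar ∘ₗ 𝓔

/-- The connected state `ρ_{B^N W}`: the `N` copies coupled to the ancilla evolve by `𝓔^{⊗ N}`
and `Bbar^N` is traced out. -/
def connectedState (N : ℕ) (ρ : Matrix (A × Abar) (A × Abar) ℂ)
    (𝓔 : Matrix (A × Abar) (A × Abar) ℂ →ₗ[ℂ] Matrix (B × Bbar) (B × Bbar) ℂ) (ψ : W → ℂ)
    (V : Matrix ((Fin N → A) × W) ((Fin N → A) × W) ℂ) :
    Matrix ((Fin N → B) × W) ((Fin N → B) × W) ℂ :=
  ampliate (mapPow N (evolveTo 𝓔)) W (coupledState N ρ ψ V)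

end Definition

section Quantities

variable {A Abar B Bbar : Type u}
  [Fintype A] [DecidableEq A] [Fintype Abar] [DecidableEq Abar]
  [Fintype B] [DecidableEq B] [Fintype Bbar] [DecidableEq Bbar]

/-- `(1/N) sup S(ρ_{B^N W} | τ^{⊗ N} ⊗ ρ_W)`, the supremum being over all finite-dimensional
ancillas `W`, all pure initial states `ψ` of `W` and all unitaries `V` on `A^N W`. Here `ρ` is the
state of `A Abar` in each copy right before the coupling, and `τ` the state of `B` in the copies
that are not coupled to `W`. -/
def optimalRate (N : ℕ) (ρ : Matrix (A × Abar) (A × Abar) ℂ) (τ : Matrix B B ℂ)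
    (𝓔 : Matrix (A × Abar) (A × Abar) ℂ →ₗ[ℂ] Matrix (B × Bbar) (B × Bbar) ℂ) : EReal :=
  (⨆ (W : Type u) (_ : Fintype W) (_ : DecidableEq W) (ψ : W → ℂ) (_ : ∑ w, ‖ψ w‖ ^ 2 = 1)
      (V : Matrix.unitaryGroup ((Fin N → A) × W) ℂ),
    relEntropy (connectedState N ρ 𝓔 ψ V.1)
      (tensorPow N τ ⊗ₖ traceFst (connectedState N ρ 𝓔 ψ V.1))) / (N : EReal)

/-- `J_N(A:B)` for the initial state `ρ` on `A Abar` and the evolution `𝓔` from `A Abar` to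
`B Bbar`. The reference state is the unperturbed evolved state `ρ_{B,0} = tr_{Bbar} 𝓔(ρ)`. -/
def stmiN (N : ℕ) (ρ : Matrix (A × Abar) (A × Abar) ℂ)
    (𝓔 : Matrix (A × Abar) (A × Abar) ℂ →ₗ[ℂ] Matrix (B × Bbar) (B × Bbar) ℂ) : EReal :=
  optimalRate N ρ (evolveTo 𝓔 ρ) 𝓔

/-- `J(A:B)`, the limit of `J_N(A:B)` as `N → ∞` (written as an upper limit, which is always
defined in the extended reals; that it is a limit is asserted separately). -/
def stmi (ρ : Matrix (A × Abar) (A × Abar) ℂ)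
    (𝓔 : Matrix (A × Abar) (A × Abar) ℂ →ₗ[ℂ] Matrix (B × Bbar) (B × Bbar) ℂ) : EReal :=
  limsup (fun N => stmiN N ρ 𝓔) atTop

/-- `J_N(A:B)` after the channel `ΦA` is applied to `A`: in each of the `N` probed copies, `ΦA` acts
on `A` before the coupling `V` does; the channel is a local operation at `A`, hence part of the
probing, and the independent copies that define `ρ_{B,0}` remain unperturbed. -/
def stmiNAfter (N : ℕ) (ΦA : Matrix A A ℂ →ₗ[ℂ] Matrix A A ℂ)
    (ρ : Matrix (A × Abar) (A × Abar) ℂ)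
    (𝓔 : Matrix (A × Abar) (A × Abar) ℂ →ₗ[ℂ] Matrix (B × Bbar) (B × Bbar) ℂ) : EReal :=
  optimalRate N (ampliate ΦA Abar ρ) (evolveTo 𝓔 ρ) 𝓔

/-- The limit of `stmiNAfter` as `N → ∞`. -/
def stmiAfter (ΦA : Matrix A A ℂ →ₗ[ℂ] Matrix A A ℂ)
    (ρ : Matrix (A × Abar) (A × Abar) ℂ)
    (𝓔 : Matrix (A × Abar) (A × Abar) ℂ →ₗ[ℂ] Matrix (B × Bbar) (B × Bbar) ℂ) : EReal :=
  limsup (fun N => stmiNAfter N ΦA ρ 𝓔) atTop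

end Quantities

/-- The identification of operators on `(X Y) Z` with operators on `X (Y Z)`. -/
def assoc (X Y Z : Type*) :
    Matrix ((X × Y) × Z) ((X × Y) × Z) ℂ ≃ₗ[ℂ] Matrix (X × (Y × Z)) (X × (Y × Z)) ℂ :=
  Matrix.reindexLinearEquiv ℂ ℂ (Equiv.prodAssoc X Y Z) (Equiv.prodAssoc X Y Z)

end STMI

end

/-! Monotonicity rests on the data processing inequality for relative entropy. A channel on `B`
sends the joint state to the new joint state and the product reference to the new product reference,
because it leaves the marginal on `W` alone; discarding `D` from `BD` is a special case. On the `A`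
side the point is the supremum over probes: a coupling at `A` is also a coupling at `AC` (tensor
with the identity), and a channel applied before the coupling can be absorbed, by Stinespring, into
a unitary coupling to a larger ancilla, part of which is then discarded. Discarding costs nothing,
again by data processing. The inequalities hold for each `N` and pass to the upper limits.

Data processing (`relEntropy_krausMap_le`) is proved by writing `S(ρ|σ)` as the limit, as `T → ∞`,
of the integral over `t ∈ [0, T]` of the quasi-entropies `⟨ρ, (L_σ + t R_ρ)⁻¹ ρ⟩`, minus `tr ρ · log
(1 + T)`. Each quasi-entropy is the maximum over matrices `M` of a concave quadratic form; pulling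
the maximizer for the output states back along the dual channel gives a trial matrix for the input
states, and the Kadison–Schwarz inequality shows that this does not lower the form.

The limits exist by Fekete's lemma in the extended reals: product probes on `N + M` copies make the
unnormalized supremum superadditive (`probeSup_add_le`), and it is nonnegative. -/

noncomputable section

namespace STMI

set_option linter.unusedSectionVars false

/-! ### Eigenvalues, eigenvector overlaps and functional calculus -/

section Spectral

variable {X : Type*} [Fintype X] [DecidableEq X]

/-- `ρ = U diag(p) U†` with `U` unitary and `p` nonnegative. -/
structure Diagonalizes (ρ U : Matrix X X ℂ) (p : X → ℝ) : Prop where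
  mul_star : U * Uᴴ = 1
  star_mul : Uᴴ * U = 1
  eq : ρ = U * Matrix.diagonal (fun i => (p i : ℂ)) * Uᴴ
  nonneg : ∀ i, 0 ≤ p i

theorem exists_diagonalizes {ρ : Matrix X X ℂ} (h : ρ.PosSemidef) :
    ∃ U p, Diagonalizes ρ U p := by
  refine ⟨h.1.eigenvectorUnitary, h.1.eigenvalues, ?_, ?_, ?_, h.eigenvalues_nonneg⟩
  · exact Unitary.mul_star_self_of_mem h.1.eigenvectorUnitary.2
  · exact Unitary.star_mul_self_of_mem h.1.eigenvectorUnitary.2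
  · exact h.1.spectral_theorem

theorem Diagonalizes.posSemidef {ρ U : Matrix X X ℂ} {p : X → ℝ} (h : Diagonalizes ρ U p) :
    ρ.PosSemidef := by
  rw [h.eq]
  refine Matrix.PosSemidef.mul_mul_conjTranspose_same (Matrix.PosSemidef.diagonal ?_) U
  intro i
  simpa using h.nonneg i

/-- Two diagonalizations of `ρ` differ by a matrix intertwining the two diagonals. Its nonzero
entries join equal eigenvalues only, so it also intertwines their images under `f`. Hence any
diagonalization may be used, such as a tensor product of two others. -/
theorem Diagonalizes.cfc_eq {ρ U : Matrix X X ℂ} {p : X → ℝ} (h : Diagonalizes ρ U p)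
    (f : ℝ → ℝ) : cfc f ρ = U * Matrix.diagonal (fun i => (f (p i) : ℂ)) * Uᴴ := by
  have hH := h.posSemidef.1
  rw [hH.cfc_eq, Matrix.IsHermitian.cfc, Unitary.conjStarAlgAut_apply]
  obtain ⟨E, hE⟩ : ∃ E : Matrix X X ℂ, E = hH.eigenvectorUnitary := ⟨_, rfl⟩
  have h1 : E * Eᴴ = 1 := hE ▸ Unitary.mul_star_self_of_mem hH.eigenvectorUnitary.2
  have h2 : Eᴴ * E = 1 := hE ▸ Unitary.star_mul_self_of_mem hH.eigenvectorUnitary.2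
  have h3 : ρ = E * Matrix.diagonal (fun i => (hH.eigenvalues i : ℂ)) * Eᴴ :=
    hE ▸ hH.spectral_theorem
  change (hH.eigenvectorUnitary : Matrix X X ℂ) *
    Matrix.diagonal (fun i => (f (hH.eigenvalues i) : ℂ)) *
      (hH.eigenvectorUnitary : Matrix X X ℂ)ᴴ = _
  rw [← hE]
  generalize hH.eigenvalues = d at h3 ⊢
  have h4 : Eᴴ * U * Matrix.diagonal (fun i => (p i : ℂ)) =
      Matrix.diagonal (fun i => (d i : ℂ)) * (Eᴴ * U) := by
    calc Eᴴ * U * Matrix.diagonal (fun i => (p i : ℂ))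
        = Eᴴ * (U * Matrix.diagonal (fun i => (p i : ℂ)) * Uᴴ) * U := by
          simp only [Matrix.mul_assoc, h.star_mul, Matrix.mul_one]
      _ = Eᴴ * (E * Matrix.diagonal (fun i => (d i : ℂ)) * Eᴴ) * U := by rw [← h3, ← h.eq]
      _ = Eᴴ * E * Matrix.diagonal (fun i => (d i : ℂ)) * (Eᴴ * U) := by
          simp only [Matrix.mul_assoc]
      _ = _ := by rw [h2, Matrix.one_mul]
  have h5 : Eᴴ * U * Matrix.diagonal (fun i => (f (p i) : ℂ)) =
      Matrix.diagonal (fun i => (f (d i) : ℂ)) * (Eᴴ * U) := by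
    ext i j
    have := congrFun (congrFun h4 i) j
    rw [Matrix.mul_diagonal, Matrix.diagonal_mul] at this ⊢
    by_cases hz : (Eᴴ * U) i j = 0
    · simp [hz]
    · rw [mul_comm] at this
      have h6 : p j = d i := by exact_mod_cast mul_right_cancel₀ hz this
      rw [h6, mul_comm]
  calc E * Matrix.diagonal (fun i => (f (d i) : ℂ)) * Eᴴ
      = E * (Matrix.diagonal (fun i => (f (d i) : ℂ)) * (Eᴴ * U)) * Uᴴ := by
        simp only [Matrix.mul_assoc, h.mul_star, Matrix.mul_one]
    _ = E * Eᴴ * (U * Matrix.diagonal (fun i => (f (p i) : ℂ)) * Uᴴ) := by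
        rw [← h5]; simp only [Matrix.mul_assoc]
    _ = _ := by rw [h1, Matrix.one_mul]

variable {ρ σ U V : Matrix X X ℂ} {p q : X → ℝ}

theorem Diagonalizes.trace_mul_cfc (hρ : Diagonalizes ρ U p) (hσ : Diagonalizes σ V q)
    (f : ℝ → ℝ) :
    (ρ * cfc f σ).trace.re = ∑ i, ∑ j, ‖(Uᴴ * V) i j‖ ^ 2 * (p i * f (q j)) := by
  have h : (ρ * cfc f σ).trace = (Matrix.diagonal (fun i => (p i : ℂ)) * ((Uᴴ * V) *
      Matrix.diagonal (fun i => (f (q i) : ℂ)) * (Uᴴ * V)ᴴ)).trace := by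
    rw [hσ.cfc_eq, hρ.eq, Matrix.conjTranspose_mul, Matrix.conjTranspose_conjTranspose]
    simp only [Matrix.mul_assoc]
    rw [Matrix.trace_mul_comm U]
    simp only [Matrix.mul_assoc]
  rw [h, Matrix.trace, Complex.re_sum]
  refine Finset.sum_congr rfl fun i _ => ?_
  rw [Matrix.diag_apply, Matrix.diagonal_mul, Matrix.mul_apply, Finset.mul_sum, Complex.re_sum]
  refine Finset.sum_congr rfl fun j _ => ?_
  rw [Matrix.mul_diagonal, Matrix.conjTranspose_apply]
  have : (p i : ℂ) * ((Uᴴ * V) i j * (f (q j) : ℂ) * star ((Uᴴ * V) i j)) =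
      ((‖(Uᴴ * V) i j‖ ^ 2 * (p i * f (q j)) : ℝ) : ℂ) := by
    have h2 := Complex.mul_conj' ((Uᴴ * V) i j)
    push_cast
    rw [← h2, ← starRingEnd_apply]
    ring
  rw [this, Complex.ofReal_re]

theorem Diagonalizes.sum_overlap (hρ : Diagonalizes ρ U p) (hσ : Diagonalizes σ V q) (i : X) :
    ∑ j, ‖(Uᴴ * V) i j‖ ^ 2 = 1 := by
  have h : (Uᴴ * V) * (Uᴴ * V)ᴴ = 1 := by
    rw [Matrix.conjTranspose_mul, Matrix.conjTranspose_conjTranspose, Matrix.mul_assoc,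
      ← Matrix.mul_assoc V, hσ.mul_star, Matrix.one_mul, hρ.star_mul]
  have h2 := congrFun (congrFun h i) i
  rw [Matrix.mul_apply, Matrix.one_apply_eq] at h2
  have h3 : ((∑ j, ‖(Uᴴ * V) i j‖ ^ 2 : ℝ) : ℂ) = 1 := by
    rw [← h2]
    push_cast
    refine Finset.sum_congr rfl fun j _ => ?_
    rw [Matrix.conjTranspose_apply, ← Complex.mul_conj', starRingEnd_apply]
  exact_mod_cast h3

theorem Diagonalizes.trace_re (hρ : Diagonalizes ρ U p) : ρ.trace.re = ∑ i, p i := by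
  rw [hρ.eq, Matrix.trace_mul_comm, ← Matrix.mul_assoc, hρ.star_mul, Matrix.one_mul,
    Matrix.trace_diagonal, Complex.re_sum]
  simp

theorem Diagonalizes.trace_re_eq_sum (hρ : Diagonalizes ρ U p) (hσ : Diagonalizes σ V q) :
    ρ.trace.re = ∑ i, ∑ j, ‖(Uᴴ * V) i j‖ ^ 2 * p i := by
  rw [hρ.trace_re]
  refine Finset.sum_congr rfl fun i _ => ?_
  rw [← Finset.sum_mul, hρ.sum_overlap hσ, one_mul]

theorem Diagonalizes.trace_mul_log_sub_log (hρ : Diagonalizes ρ U p) (hσ : Diagonalizes σ V q) :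
    (ρ * (cfc Real.log ρ - cfc Real.log σ)).trace.re =
      ∑ i, ∑ j, ‖(Uᴴ * V) i j‖ ^ 2 * (p i * (Real.log (p i) - Real.log (q j))) := by
  rw [Matrix.mul_sub, Matrix.trace_sub, Complex.sub_re, hρ.trace_mul_cfc hσ]
  have h1 : (ρ * cfc Real.log ρ).trace.re =
      ∑ i, ∑ j, ‖(Uᴴ * V) i j‖ ^ 2 * (p i * Real.log (p i)) := by
    -- The overlap of the eigenbasis of `ρ` with itself is the identity. The overlaps with `σ` enter
    -- only through their row sums, which are 1, so that both terms become sums over the same pairs.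
    rw [hρ.trace_mul_cfc hρ, hρ.star_mul]
    refine Finset.sum_congr rfl fun i _ => ?_
    rw [← Finset.sum_mul, hρ.sum_overlap hσ, one_mul, Finset.sum_eq_single i]
    · simp
    · intro j _ hj
      simp [Matrix.one_apply_ne hj.symm]
    · simp
  rw [h1, ← Finset.sum_sub_distrib]
  refine Finset.sum_congr rfl fun i _ => ?_
  rw [← Finset.sum_sub_distrib]
  refine Finset.sum_congr rfl fun j _ => ?_
  ring

/-- The inclusion of supports in terms of the overlaps of the eigenvectors. -/
theorem Diagonalizes.ker_le_iff (hρ : Diagonalizes ρ U p) (hσ : Diagonalizes σ V q) :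
    (∀ v : X → ℂ, σ *ᵥ v = 0 → ρ *ᵥ v = 0) ↔
      ∀ i j, q j = 0 → (p i : ℂ) * (Uᴴ * V) i j = 0 := by
  have key : Uᴴ * ρ * V = Matrix.diagonal (fun i => (p i : ℂ)) * (Uᴴ * V) := by
    rw [hρ.eq]
    simp only [← Matrix.mul_assoc, hρ.star_mul, Matrix.one_mul]
  have key2 : Vᴴ * σ = Matrix.diagonal (fun i => (q i : ℂ)) * Vᴴ := by
    rw [hσ.eq]
    simp only [← Matrix.mul_assoc, hσ.star_mul, Matrix.one_mul]
  constructor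
  · intro h i j hj
    have h1 : σ *ᵥ (V *ᵥ Pi.single j 1) = 0 := by
      rw [hσ.eq, Matrix.mulVec_mulVec, Matrix.mul_assoc, hσ.star_mul, Matrix.mul_one,
        ← Matrix.mulVec_mulVec]
      have : Matrix.diagonal (fun i => (q i : ℂ)) *ᵥ Pi.single j 1 = 0 := by
        ext k
        rw [Matrix.mulVec_diagonal]
        rcases eq_or_ne k j with rfl | hk
        · simp [hj]
        · simp [hk]
      rw [this, Matrix.mulVec_zero]
    have h2 := congrArg (Uᴴ *ᵥ ·) (h _ h1)
    simp only [Matrix.mulVec_mulVec, Matrix.mulVec_zero, key, ← Matrix.mul_assoc] at h2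
    rw [Matrix.mul_assoc, Matrix.mulVec_single_one] at h2
    have := congrFun h2 i
    simpa [Matrix.diagonal_mul] using this
  · intro h v hv
    have h1 : ∀ j, (q j : ℂ) * (Vᴴ *ᵥ v) j = 0 := by
      intro j
      have := congrFun (congrArg (Vᴴ *ᵥ ·) hv) j
      simp only [Matrix.mulVec_mulVec, Matrix.mulVec_zero, key2] at this
      rw [← Matrix.mulVec_mulVec, Matrix.mulVec_diagonal] at this
      simpa using this
    have h2 : ρ *ᵥ v = U *ᵥ ((Uᴴ * ρ * V) *ᵥ (Vᴴ *ᵥ v)) := by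
      simp only [Matrix.mulVec_mulVec]
      congr 1
      rw [Matrix.mul_assoc, Matrix.mul_assoc, hσ.mul_star, Matrix.mul_one, ← Matrix.mul_assoc,
        hρ.mul_star, Matrix.one_mul]
    have h3 : (Uᴴ * ρ * V) *ᵥ (Vᴴ *ᵥ v) = 0 := by
      ext i
      rw [key, Matrix.mulVec, dotProduct]
      refine Finset.sum_eq_zero fun j _ => ?_
      rw [Matrix.diagonal_mul]
      rcases mul_eq_zero.1 (h1 j) with h4 | h4
      · rw [h i j (by exact_mod_cast h4), zero_mul]
      · rw [h4, mul_zero]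
    rw [h2, h3, Matrix.mulVec_zero]

end Spectral

/-! ### Quasi-entropies as maxima of quadratic forms -/

section QuasiEntropy

variable {X : Type*} [Fintype X] [DecidableEq X]

/-- The concave functional of `M` whose maximum is the quasi-entropy
`⟨ρ, (L_σ + t R_ρ)⁻¹ ρ⟩`. -/
def quasiForm (t : ℝ) (ρ σ M : Matrix X X ℂ) : ℝ :=
  2 * (M * ρ).trace.re - (σ * (M * Mᴴ)).trace.re - t * (ρ * (Mᴴ * M)).trace.re

/-- `⟨ρ, (L_σ + t R_ρ)⁻¹ ρ⟩` in terms of the eigenvalues and the overlaps of the eigenvectors. -/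
def quasiSum (t : ℝ) (p q : X → ℝ) (C : Matrix X X ℂ) : ℝ :=
  ∑ i, ∑ j, ‖C i j‖ ^ 2 * (p i ^ 2 / (q j + t * p i))

theorem re_trace_diagonal_mul_mul_star {Y : Type*} [Fintype Y] (d : X → ℝ) (M : Matrix X Y ℂ) :
    (Matrix.diagonal (fun i => (d i : ℂ)) * (M * Mᴴ)).trace.re =
      ∑ i, ∑ j, d i * ‖M i j‖ ^ 2 := by
  rw [Matrix.trace, Complex.re_sum]
  refine Finset.sum_congr rfl fun i _ => ?_
  rw [Matrix.diag_apply, Matrix.diagonal_mul, Matrix.mul_apply, Finset.mul_sum, Complex.re_sum]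
  refine Finset.sum_congr rfl fun j _ => ?_
  rw [Matrix.conjTranspose_apply, ← starRingEnd_apply, Complex.mul_conj']
  norm_cast

variable {ρ σ U V : Matrix X X ℂ} {p q : X → ℝ}

/-- In the eigenbases of `σ` (rows) and `ρ` (columns), left multiplication by `σ` and right
multiplication by `ρ` are both diagonal, so the form decouples into one scalar quadratic per pair of
eigenvectors. -/
theorem quasiForm_eq (hρ : Diagonalizes ρ U p) (hσ : Diagonalizes σ V q) (t : ℝ)
    (Y : Matrix X X ℂ) :
    quasiForm t ρ σ (V * Y * Uᴴ) = ∑ i, ∑ j, (2 * (p i * ((Uᴴ * V) i j * Y j i).re) -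
      (q j + t * p i) * ‖Y j i‖ ^ 2) := by
  have e1 : (V * Y * Uᴴ * ρ).trace.re = ∑ i, ∑ j, p i * ((Uᴴ * V) i j * Y j i).re := by
    have : (V * Y * Uᴴ * ρ).trace =
        ((Uᴴ * V * Y) * Matrix.diagonal (fun i => (p i : ℂ))).trace := by
      rw [hρ.eq]
      calc (V * Y * Uᴴ * (U * Matrix.diagonal (fun i => (p i : ℂ)) * Uᴴ)).trace
          = ((V * Y * (Uᴴ * U) * Matrix.diagonal (fun i => (p i : ℂ))) * Uᴴ).trace := by
            simp only [Matrix.mul_assoc]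
        _ = _ := by
            rw [hρ.star_mul, Matrix.mul_one, Matrix.trace_mul_comm]
            simp only [Matrix.mul_assoc]
    rw [this, Matrix.trace, Complex.re_sum]
    refine Finset.sum_congr rfl fun i _ => ?_
    rw [Matrix.diag_apply, Matrix.mul_diagonal, Matrix.mul_apply, Finset.sum_mul, Complex.re_sum]
    refine Finset.sum_congr rfl fun j _ => ?_
    rw [mul_comm, Complex.re_ofReal_mul]
  have e2 : (σ * ((V * Y * Uᴴ) * (V * Y * Uᴴ)ᴴ)).trace.re = ∑ i, ∑ j, q j * ‖Y j i‖ ^ 2 := by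
    have : (σ * ((V * Y * Uᴴ) * (V * Y * Uᴴ)ᴴ)).trace =
        (Matrix.diagonal (fun i => (q i : ℂ)) * (Y * Yᴴ)).trace := by
      rw [hσ.eq]
      simp only [Matrix.conjTranspose_mul, Matrix.conjTranspose_conjTranspose]
      calc (V * Matrix.diagonal (fun i => (q i : ℂ)) * Vᴴ * (V * Y * Uᴴ * (U * (Yᴴ * Vᴴ)))).trace
          = (V * (Matrix.diagonal (fun i => (q i : ℂ)) * ((Vᴴ * V) * Y * (Uᴴ * U) * Yᴴ * Vᴴ))).trace
              := by simp only [Matrix.mul_assoc]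
        _ = _ := by
            rw [hρ.star_mul, hσ.star_mul, Matrix.trace_mul_comm, Matrix.one_mul, Matrix.mul_one]
            simp only [Matrix.mul_assoc, hσ.star_mul, Matrix.mul_one]
    rw [this, re_trace_diagonal_mul_mul_star, Finset.sum_comm]
  have e3 : (ρ * ((V * Y * Uᴴ)ᴴ * (V * Y * Uᴴ))).trace.re = ∑ i, ∑ j, p i * ‖Y j i‖ ^ 2 := by
    have : (ρ * ((V * Y * Uᴴ)ᴴ * (V * Y * Uᴴ))).trace =
        (Matrix.diagonal (fun i => (p i : ℂ)) * (Yᴴ * Yᴴᴴ)).trace := by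
      rw [hρ.eq]
      simp only [Matrix.conjTranspose_mul, Matrix.conjTranspose_conjTranspose]
      calc (U * Matrix.diagonal (fun i => (p i : ℂ)) * Uᴴ * (U * (Yᴴ * Vᴴ) * (V * Y * Uᴴ))).trace
          = (U * (Matrix.diagonal (fun i => (p i : ℂ)) * ((Uᴴ * U) * Yᴴ * (Vᴴ * V) * Y * Uᴴ))).trace
              := by simp only [Matrix.mul_assoc]
        _ = _ := by
            rw [hρ.star_mul, hσ.star_mul, Matrix.trace_mul_comm, Matrix.one_mul, Matrix.mul_one]
            simp only [Matrix.mul_assoc, hρ.star_mul, Matrix.mul_one]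
    rw [this, re_trace_diagonal_mul_mul_star]
    simp
  rw [quasiForm, e1, e2, e3, Finset.mul_sum, Finset.mul_sum, ← Finset.sum_sub_distrib,
    ← Finset.sum_sub_distrib]
  refine Finset.sum_congr rfl fun i _ => ?_
  rw [Finset.mul_sum, Finset.mul_sum, ← Finset.sum_sub_distrib, ← Finset.sum_sub_distrib]
  refine Finset.sum_congr rfl fun j _ => ?_
  ring

/-- Complete the square in each entry. If the coefficient `q j + t * p i` vanishes there is no
square to complete; the support condition then makes the linear term vanish as well. -/
theorem quasiForm_le_quasiSum (hρ : Diagonalizes ρ U p) (hσ : Diagonalizes σ V q)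
    (hs : ∀ v : X → ℂ, σ *ᵥ v = 0 → ρ *ᵥ v = 0) {t : ℝ} (ht : 0 ≤ t) (M : Matrix X X ℂ) :
    quasiForm t ρ σ M ≤ quasiSum t p q (Uᴴ * V) := by
  have hM : M = V * (Vᴴ * M * U) * Uᴴ := by
    simp only [← Matrix.mul_assoc, hσ.mul_star, Matrix.one_mul]
    rw [Matrix.mul_assoc, hρ.mul_star, Matrix.mul_one]
  rw [hM, quasiForm_eq hρ hσ, quasiSum]
  refine Finset.sum_le_sum fun i _ => Finset.sum_le_sum fun j _ => ?_
  generalize (Vᴴ * M * U) j i = y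
  have hp := hρ.nonneg i
  have hq := hσ.nonneg j
  have hsup := (hρ.ker_le_iff hσ).1 hs i j
  generalize (Uᴴ * V) i j = c at hsup ⊢
  have hre : (c * y).re ≤ ‖c‖ * ‖y‖ := (Complex.re_le_norm _).trans (norm_mul c y).le
  have htp := mul_nonneg ht hp
  rcases (add_nonneg hq htp).eq_or_lt with h0 | h0
  · have hq0 : q j = 0 := by linarith
    rcases mul_eq_zero.1 (hsup hq0) with h1 | h1
    · have : p i = 0 := by exact_mod_cast h1
      simp [this, hq0]
    · simp [h1, ← h0]
  · have h1 : ‖c‖ ^ 2 * (p i ^ 2 / (q j + t * p i)) = (‖c‖ * p i) ^ 2 / (q j + t * p i) := by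
      rw [mul_pow, mul_div_assoc]
    rw [h1, le_div_iff₀ h0]
    have h2 := mul_le_mul_of_nonneg_left hre (mul_nonneg hp h0.le)
    nlinarith [sq_nonneg (‖c‖ * p i - (q j + t * p i) * ‖y‖)]

theorem exists_quasiForm_eq_quasiSum (hρ : Diagonalizes ρ U p) (hσ : Diagonalizes σ V q) (t : ℝ) :
    ∃ M, quasiForm t ρ σ M = quasiSum t p q (Uᴴ * V) := by
  -- Each entry is the critical point of its scalar quadratic. Where the denominator vanishes,
  -- division by zero returns 0 and both sides are 0.
  refine ⟨V * (Matrix.of fun j i => ((p i / (q j + t * p i) : ℝ) : ℂ) * star ((Uᴴ * V) i j)) * Uᴴ,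
    ?_⟩
  rw [quasiForm_eq hρ hσ, quasiSum]
  refine Finset.sum_congr rfl fun i _ => Finset.sum_congr rfl fun j _ => ?_
  rw [Matrix.of_apply]
  generalize (Uᴴ * V) i j = c
  have h1 : (c * (((p i / (q j + t * p i) : ℝ) : ℂ) * star c)).re =
      p i / (q j + t * p i) * ‖c‖ ^ 2 := by
    have : c * (((p i / (q j + t * p i) : ℝ) : ℂ) * star c) =
        ((p i / (q j + t * p i) * ‖c‖ ^ 2 : ℝ) : ℂ) := by
      have h2 := Complex.mul_conj' c
      rw [Complex.ofReal_mul, Complex.ofReal_pow, ← h2, ← starRingEnd_apply]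
      ring
    rw [this, Complex.ofReal_re]
  rw [h1, norm_mul, Complex.norm_real, norm_star, mul_pow, Real.norm_eq_abs, sq_abs]
  by_cases h0 : q j + t * p i = 0
  · simp [h0]
  · field_simp
    ring

end QuasiEntropy

/-! ### Kraus maps, their duals and the Schwarz inequality -/

section Kraus

variable {X Y ι : Type*} [Fintype X] [Fintype ι]

/-- The map `M ↦ ∑ₖ Kₖ M Kₖ†`. -/
def krausMap (K : ι → Matrix Y X ℂ) : Matrix X X ℂ →ₗ[ℂ] Matrix Y Y ℂ where
  toFun M := ∑ k, K k * M * (K k)ᴴ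
  map_add' M M' := by simp [Matrix.mul_add, Matrix.add_mul, Finset.sum_add_distrib]
  map_smul' c M := by simp [Finset.smul_sum]

theorem krausMap_apply (K : ι → Matrix Y X ℂ) (M : Matrix X X ℂ) :
    krausMap K M = ∑ k, K k * M * (K k)ᴴ := rfl

variable [Fintype Y]

theorem krausMap_posSemidef (K : ι → Matrix Y X ℂ) {M : Matrix X X ℂ} (hM : M.PosSemidef) :
    (krausMap K M).PosSemidef :=
  Matrix.posSemidef_sum _ fun k _ => hM.mul_mul_conjTranspose_same (K k)

theorem trace_mul_krausMap (K : ι → Matrix Y X ℂ) (M : Matrix X X ℂ) (Z : Matrix Y Y ℂ) :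
    (Z * krausMap K M).trace = (krausMap (fun k => (K k)ᴴ) Z * M).trace := by
  simp only [krausMap_apply, Matrix.mul_sum, Matrix.sum_mul, Matrix.trace_sum,
    Matrix.conjTranspose_conjTranspose]
  refine Finset.sum_congr rfl fun k _ => ?_
  rw [← Matrix.mul_assoc, Matrix.trace_mul_comm]
  simp only [Matrix.mul_assoc]

theorem trace_krausMap [DecidableEq X] (K : ι → Matrix Y X ℂ) (hK : ∑ k, (K k)ᴴ * K k = 1)
    (M : Matrix X X ℂ) : (krausMap K M).trace = M.trace := by
  classical
  have h := trace_mul_krausMap K M 1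
  rw [Matrix.one_mul] at h
  rw [h, krausMap_apply]
  simp [hK]

/-- The Kadison–Schwarz inequality for the dual of a channel, with its defect written as a sum of
squares. -/
theorem krausMap_dual_schwarz [DecidableEq X] (K : ι → Matrix Y X ℂ)
    (hK : ∑ k, (K k)ᴴ * K k = 1) (Z : Matrix Y Y ℂ) :
    krausMap (fun k => (K k)ᴴ) (Z * Zᴴ) =
      krausMap (fun k => (K k)ᴴ) Z * (krausMap (fun k => (K k)ᴴ) Z)ᴴ +
      ∑ k, (Zᴴ * K k - K k * (krausMap (fun k => (K k)ᴴ) Z)ᴴ)ᴴ *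
        (Zᴴ * K k - K k * (krausMap (fun k => (K k)ᴴ) Z)ᴴ) := by
  obtain ⟨T, hT⟩ : ∃ T, T = krausMap (fun k => (K k)ᴴ) Z := ⟨_, rfl⟩
  rw [← hT]
  have hT1 : ∑ k, (K k)ᴴ * Z * K k = T := by simp [hT, krausMap_apply]
  have hT2 : ∑ k, (K k)ᴴ * Zᴴ * K k = Tᴴ := by
    rw [← hT1, Matrix.conjTranspose_sum]
    simp [Matrix.mul_assoc]
  have e : ∀ k, (Zᴴ * K k - K k * Tᴴ)ᴴ * (Zᴴ * K k - K k * Tᴴ) =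
      (K k)ᴴ * (Z * Zᴴ) * K k - (K k)ᴴ * Z * K k * Tᴴ - T * ((K k)ᴴ * Zᴴ * K k) +
        T * ((K k)ᴴ * K k) * Tᴴ := by
    intro k
    simp only [Matrix.conjTranspose_sub, Matrix.conjTranspose_mul,
      Matrix.conjTranspose_conjTranspose, Matrix.sub_mul, Matrix.mul_sub, Matrix.mul_assoc]
    abel
  simp only [e, Finset.sum_add_distrib, Finset.sum_sub_distrib, ← Finset.sum_mul,
    ← Finset.mul_sum, hT1, hT2, hK]
  simp only [krausMap_apply, Matrix.conjTranspose_conjTranspose, Matrix.mul_one]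
  abel

/-- Moving the Kraus map to the other side of the trace turns the right-hand side into the dual map
of `Z * Zᴴ`. The Schwarz defect is a sum of terms `Rᴴ * R`, whose trace against `σ` is nonnegative.
-/
theorem re_trace_mul_le_of_schwarz [DecidableEq X] (K : ι → Matrix Y X ℂ)
    (hK : ∑ k, (K k)ᴴ * K k = 1) (Z : Matrix Y Y ℂ) {σ : Matrix X X ℂ} (hσ : σ.PosSemidef) :
    (σ * (krausMap (fun k => (K k)ᴴ) Z * (krausMap (fun k => (K k)ᴴ) Z)ᴴ)).trace.re ≤
      (krausMap K σ * (Z * Zᴴ)).trace.re := by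
  rw [Matrix.trace_mul_comm (krausMap K σ), trace_mul_krausMap, Matrix.trace_mul_comm _ σ,
    krausMap_dual_schwarz K hK, Matrix.mul_add, Matrix.trace_add, Complex.add_re,
    le_add_iff_nonneg_right, Matrix.mul_sum, Matrix.trace_sum, Complex.re_sum]
  refine Finset.sum_nonneg fun k _ => ?_
  generalize (Zᴴ * K k - K k * (krausMap (fun k => (K k)ᴴ) Z)ᴴ) = R
  rw [← Matrix.mul_assoc, Matrix.trace_mul_comm, ← Matrix.mul_assoc]
  exact (Complex.le_def.1 (hσ.mul_mul_conjTranspose_same R).trace_nonneg).1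

/-- The linear term is unchanged by duality. The two quadratic terms enter with a minus sign and can
only shrink: Schwarz is applied to `Z` against `σ` and to `Zᴴ` against `ρ`. -/
theorem quasiForm_krausMap_le [DecidableEq X] [DecidableEq Y] (K : ι → Matrix Y X ℂ)
    (hK : ∑ k, (K k)ᴴ * K k = 1) {ρ σ : Matrix X X ℂ} (hρ : ρ.PosSemidef) (hσ : σ.PosSemidef)
    {t : ℝ} (ht : 0 ≤ t) (Z : Matrix Y Y ℂ) :
    quasiForm t (krausMap K ρ) (krausMap K σ) Z ≤
      quasiForm t ρ σ (krausMap (fun k => (K k)ᴴ) Z) := by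
  have h1 := re_trace_mul_le_of_schwarz K hK Z hσ
  have h2 := re_trace_mul_le_of_schwarz K hK Zᴴ hρ
  have h3 : krausMap (fun k => (K k)ᴴ) Zᴴ = (krausMap (fun k => (K k)ᴴ) Z)ᴴ := by
    simp [krausMap_apply, Matrix.conjTranspose_sum, Matrix.mul_assoc]
  rw [h3, Matrix.conjTranspose_conjTranspose, Matrix.conjTranspose_conjTranspose] at h2
  have h4 := mul_le_mul_of_nonneg_left h2 ht
  rw [quasiForm, quasiForm, trace_mul_krausMap]
  linarith

/-- The expectation of the image of `σ` in `v` is a sum of nonnegative terms, so if it vanishes then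
each `(K k)ᴴ *ᵥ v` lies in the kernel of `σ`, hence in that of `ρ`. -/
theorem krausMap_ker_le (K : ι → Matrix Y X ℂ) {ρ σ : Matrix X X ℂ} (hσ : σ.PosSemidef)
    (hs : ∀ v : X → ℂ, σ *ᵥ v = 0 → ρ *ᵥ v = 0) (v : Y → ℂ) (hv : krausMap K σ *ᵥ v = 0) :
    krausMap K ρ *ᵥ v = 0 := by
  have h1 : ∑ k, star ((K k)ᴴ *ᵥ v) ⬝ᵥ (σ *ᵥ ((K k)ᴴ *ᵥ v)) = 0 := by
    have h2 : star v ⬝ᵥ (krausMap K σ *ᵥ v) = 0 := by rw [hv, dotProduct_zero]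
    rw [← h2, krausMap_apply, Matrix.sum_mulVec, dotProduct_sum]
    refine Finset.sum_congr rfl fun k _ => ?_
    rw [← Matrix.mulVec_mulVec, ← Matrix.mulVec_mulVec, Matrix.star_mulVec,
      Matrix.conjTranspose_conjTranspose, ← Matrix.dotProduct_mulVec]
  rw [Finset.sum_eq_zero_iff_of_nonneg fun k _ => hσ.dotProduct_mulVec_nonneg _] at h1
  rw [krausMap_apply, Matrix.sum_mulVec]
  refine Finset.sum_eq_zero fun k hk => ?_
  rw [← Matrix.mulVec_mulVec, ← Matrix.mulVec_mulVec,
    hs _ ((hσ.dotProduct_mulVec_zero_iff _).1 (h1 k hk)), Matrix.mulVec_zero]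

end Kraus

/-! ### Integral representation and data processing inequality -/

section DataProcessing

theorem integral_sq_div_add_mul {p q T : ℝ} (hp : 0 < p) (hq : 0 < q) (hT : 0 ≤ T) :
    ∫ t in (0 : ℝ)..T, p ^ 2 / (q + t * p) = p * (Real.log (q + T * p) - Real.log q) := by
  have hpos : ∀ t ∈ Set.uIcc (0 : ℝ) T, 0 < q + t * p := by
    intro t ht
    rw [Set.uIcc_of_le hT] at ht
    have := mul_nonneg ht.1 hp.le
    linarith
  have hd : ∀ t ∈ Set.uIcc (0 : ℝ) T,
      HasDerivAt (fun t => p * Real.log (q + t * p)) (p ^ 2 / (q + t * p)) t := by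
    intro t ht
    have h1 : HasDerivAt (fun t : ℝ => q + t * p) p t := by
      simpa using ((hasDerivAt_id t).mul_const p).const_add q
    exact ((h1.log (hpos t ht).ne').const_mul p).congr_deriv (by ring)
  rw [intervalIntegral.integral_eq_sub_of_hasDerivAt hd]
  · simp
    ring
  · refine ContinuousOn.intervalIntegrable ?_
    refine ContinuousOn.div (by fun_prop) (by fun_prop) fun t ht => (hpos t ht).ne'

theorem tendsto_log_add_mul_sub_log {p q : ℝ} (hp : 0 < p) :
    Tendsto (fun T : ℝ => Real.log (q + T * p) - Real.log (1 + T)) atTop (𝓝 (Real.log p)) := by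
  have h1 : Tendsto (fun T : ℝ => (q - p) / (1 + T) + p) atTop (𝓝 (0 + p)) := by
    refine Tendsto.add_const p (Tendsto.div_atTop tendsto_const_nhds ?_)
    exact tendsto_atTop_add_const_left _ _ tendsto_id
  rw [zero_add] at h1
  refine (h1.log hp.ne').congr' ?_
  have h2 : ∀ᶠ T : ℝ in atTop, 0 < q + T * p := by
    have : Tendsto (fun T : ℝ => q + T * p) atTop atTop :=
      tendsto_atTop_add_const_left _ _ (tendsto_id.atTop_mul_const hp)
    exact this.eventually_gt_atTop 0
  filter_upwards [h2, eventually_ge_atTop 0] with T hT hT0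
  have h3 : 1 + T ≠ 0 := by linarith
  rw [← Real.log_div hT.ne' h3]
  congr 1
  field_simp
  ring

variable {X : Type*} [Fintype X] [DecidableEq X] {ρ σ U V : Matrix X X ℂ} {p q : X → ℝ}

theorem continuousOn_quasiSum_term (hρ : Diagonalizes ρ U p) (hσ : Diagonalizes σ V q)
    (hs : ∀ v : X → ℂ, σ *ᵥ v = 0 → ρ *ᵥ v = 0) (i j : X) :
    ContinuousOn (fun t => ‖(Uᴴ * V) i j‖ ^ 2 * (p i ^ 2 / (q j + t * p i))) (Set.Ici 0) := by
  rcases eq_or_ne ((p i : ℂ) * (Uᴴ * V) i j) 0 with h | h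
  · have h0 : (fun t => ‖(Uᴴ * V) i j‖ ^ 2 * (p i ^ 2 / (q j + t * p i))) = fun _ => 0 := by
      funext t
      rcases mul_eq_zero.1 h with h | h
      · have : p i = 0 := by exact_mod_cast h
        simp [this]
      · simp [h]
    rw [h0]
    exact continuousOn_const
  · have hq : 0 < q j := lt_of_le_of_ne (hσ.nonneg j)
      fun h0 => h ((hρ.ker_le_iff hσ).1 hs i j h0.symm)
    refine ContinuousOn.mul continuousOn_const
      (ContinuousOn.div (by fun_prop) (by fun_prop) fun t ht => ?_)
    have := mul_nonneg (Set.mem_Ici.1 ht) (hρ.nonneg i)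
    linarith

theorem intervalIntegrable_quasiSum_term (hρ : Diagonalizes ρ U p) (hσ : Diagonalizes σ V q)
    (hs : ∀ v : X → ℂ, σ *ᵥ v = 0 → ρ *ᵥ v = 0) (i j : X) {T : ℝ} (hT : 0 ≤ T) :
    IntervalIntegrable (fun t => ‖(Uᴴ * V) i j‖ ^ 2 * (p i ^ 2 / (q j + t * p i)))
      MeasureTheory.volume 0 T := by
  refine ((continuousOn_quasiSum_term hρ hσ hs i j).mono fun t ht => ?_).intervalIntegrable
  rw [Set.uIcc_of_le hT] at ht
  exact ht.1

theorem intervalIntegrable_quasiSum (hρ : Diagonalizes ρ U p) (hσ : Diagonalizes σ V q)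
    (hs : ∀ v : X → ℂ, σ *ᵥ v = 0 → ρ *ᵥ v = 0) {T : ℝ} (hT : 0 ≤ T) :
    IntervalIntegrable (fun t => quasiSum t p q (Uᴴ * V)) MeasureTheory.volume 0 T := by
  have h : ContinuousOn (fun t => quasiSum t p q (Uᴴ * V)) (Set.Ici 0) :=
    continuousOn_finsetSum _ fun i _ => continuousOn_finsetSum _ fun j _ =>
      continuousOn_quasiSum_term hρ hσ hs i j
  refine (h.mono fun t ht => ?_).intervalIntegrable
  rw [Set.uIcc_of_le hT] at ht
  exact ht.1

/-- The relative entropy as an integral of quasi-entropies. -/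
theorem tendsto_integral_quasiSum (hρ : Diagonalizes ρ U p) (hσ : Diagonalizes σ V q)
    (hs : ∀ v : X → ℂ, σ *ᵥ v = 0 → ρ *ᵥ v = 0) :
    Tendsto (fun T : ℝ => (∫ t in (0 : ℝ)..T, quasiSum t p q (Uᴴ * V)) -
        ρ.trace.re * Real.log (1 + T)) atTop
      (𝓝 (ρ * (cfc Real.log ρ - cfc Real.log σ)).trace.re) := by
  rw [hρ.trace_mul_log_sub_log hσ]
  -- The integral of one term is `p (log (q + T p) - log q)` up to its weight. It diverges like `p
  -- log (1 + T)`; after this is subtracted, `p (log p - log q)` remains in the limit. Terms of zero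
  -- weight or zero `p i` are treated apart, and for the others the support condition gives `0 < q
  -- j`.
  have hterm : ∀ i j, Tendsto (fun T : ℝ =>
      (∫ t in (0 : ℝ)..T, ‖(Uᴴ * V) i j‖ ^ 2 * (p i ^ 2 / (q j + t * p i))) -
        ‖(Uᴴ * V) i j‖ ^ 2 * p i * Real.log (1 + T)) atTop
      (𝓝 (‖(Uᴴ * V) i j‖ ^ 2 * (p i * (Real.log (p i) - Real.log (q j))))) := by
    intro i j
    rcases eq_or_ne ((p i : ℂ) * (Uᴴ * V) i j) 0 with h | h
    · rcases mul_eq_zero.1 h with h | h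
      · have : p i = 0 := by exact_mod_cast h
        simp [this]
      · simp [h]
    · have hq : 0 < q j := lt_of_le_of_ne (hσ.nonneg j)
        fun h0 => h ((hρ.ker_le_iff hσ).1 hs i j h0.symm)
      have hp : 0 < p i := lt_of_le_of_ne (hρ.nonneg i) fun h0 => h (by simp [← h0])
      have h1 := (((tendsto_log_add_mul_sub_log (q := q j) hp).sub_const
        (Real.log (q j))).const_mul (p i)).const_mul (‖(Uᴴ * V) i j‖ ^ 2)
      refine h1.congr' ?_
      filter_upwards [eventually_ge_atTop 0] with T hT
      rw [intervalIntegral.integral_const_mul, integral_sq_div_add_mul hp hq hT]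
      ring
  have hsum := tendsto_finsetSum Finset.univ fun i _ =>
    tendsto_finsetSum Finset.univ fun j _ => hterm i j
  refine hsum.congr' ?_
  filter_upwards [eventually_ge_atTop 0] with T hT
  rw [hρ.trace_re_eq_sum hσ, Finset.sum_mul]
  simp only [quasiSum, Finset.sum_mul]
  rw [intervalIntegral.integral_finsetSum, ← Finset.sum_sub_distrib]
  · refine Finset.sum_congr rfl fun i _ => ?_
    rw [intervalIntegral.integral_finsetSum, ← Finset.sum_sub_distrib]
    exact fun j _ => intervalIntegrable_quasiSum_term hρ hσ hs i j hT
  · intro i _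
    have h : ContinuousOn (fun t => ∑ j, ‖(Uᴴ * V) i j‖ ^ 2 * (p i ^ 2 / (q j + t * p i)))
        (Set.Ici 0) :=
      continuousOn_finsetSum _ fun j _ => continuousOn_quasiSum_term hρ hσ hs i j
    refine (h.mono fun t ht => ?_).intervalIntegrable
    rw [Set.uIcc_of_le hT] at ht
    exact ht.1

/-- **Data processing inequality**: the relative entropy does not increase under a channel. -/
theorem relEntropy_krausMap_le {Y ι : Type*} [Fintype Y] [DecidableEq Y] [Fintype ι]
    (K : ι → Matrix Y X ℂ) (hK : ∑ k, (K k)ᴴ * K k = 1) (hρ : ρ.PosSemidef)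
    (hσ : σ.PosSemidef) : relEntropy (krausMap K ρ) (krausMap K σ) ≤ relEntropy ρ σ := by
  by_cases hs : ∀ v : X → ℂ, σ *ᵥ v = 0 → ρ *ᵥ v = 0
  swap
  · rw [relEntropy.eq_def ρ σ, if_neg hs]
    exact le_top
  have hs' : ∀ v : Y → ℂ, krausMap K σ *ᵥ v = 0 → krausMap K ρ *ᵥ v = 0 :=
    krausMap_ker_le K hσ hs
  rw [relEntropy, relEntropy, if_pos hs, if_pos hs', EReal.coe_le_coe_iff]
  obtain ⟨U, p, hU⟩ := exists_diagonalizes hρ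
  obtain ⟨V, q, hV⟩ := exists_diagonalizes hσ
  obtain ⟨U', p', hU'⟩ := exists_diagonalizes (krausMap_posSemidef K hρ)
  obtain ⟨V', q', hV'⟩ := exists_diagonalizes (krausMap_posSemidef K hσ)
  -- The subtracted logarithm has the same coefficient on both sides because the trace is preserved,
  -- so it suffices to compare the integrands pointwise in `t`.
  refine le_of_tendsto_of_tendsto (tendsto_integral_quasiSum hU' hV' hs')
    (tendsto_integral_quasiSum hU hV hs) ?_
  filter_upwards [eventually_ge_atTop 0] with T hT
  rw [trace_krausMap K hK]
  refine sub_le_sub_right (intervalIntegral.integral_mono_on hT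
    (intervalIntegrable_quasiSum hU' hV' hs' hT) (intervalIntegrable_quasiSum hU hV hs hT)
    fun t ht => ?_) _
  -- The maximizer for the output pair; its image under the dual map is the trial matrix for the
  -- input pair.
  obtain ⟨Z, hZ⟩ := exists_quasiForm_eq_quasiSum hU' hV' t
  rw [← hZ]
  exact (quasiForm_krausMap_le K hK hρ hσ ht.1 Z).trans
    (quasiForm_le_quasiSum hU hV hs ht.1 _)

end DataProcessing

/-! ### Kraus form of channels and its stability under composition and tensor products -/

section Channels

/-- Channels given by Kraus operators. -/
def IsKraus {X Y : Type u} [Fintype X] [DecidableEq X]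
    (Φ : Matrix X X ℂ →ₗ[ℂ] Matrix Y Y ℂ) [Fintype Y] : Prop :=
  ∃ (ι : Type u) (_ : Fintype ι) (K : ι → Matrix Y X ℂ),
    Φ = krausMap K ∧ ∑ k, (K k)ᴴ * K k = 1

section Basic

variable {X Y Z : Type u} [Fintype X] [DecidableEq X] [Fintype Y] [DecidableEq Y]
  [Fintype Z] [DecidableEq Z]

theorem apply_eq_sum_single (Φ : Matrix X X ℂ →ₗ[ℂ] Matrix Y Y ℂ) (M : Matrix X X ℂ) (y y' : Y) :
    Φ M y y' = ∑ x, ∑ x', M x x' * Φ (Matrix.single x x' 1) y y' := by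
  conv_lhs => rw [Matrix.matrix_eq_sum_single M]
  simp only [map_sum, Matrix.sum_apply]
  refine Finset.sum_congr rfl fun x _ => Finset.sum_congr rfl fun x' _ => ?_
  have : Matrix.single x x' (M x x') = M x x' • Matrix.single x x' (1 : ℂ) := by
    rw [Matrix.smul_single, smul_eq_mul, mul_one]
  rw [this, map_smul, Matrix.smul_apply, smul_eq_mul]

theorem exists_eq_conjTranspose_mul_self {M : Matrix X X ℂ} (hM : M.PosSemidef) :
    ∃ B : Matrix X X ℂ, M = Bᴴ * B := by
  obtain ⟨U, p, h⟩ := exists_diagonalizes hM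
  refine ⟨Matrix.diagonal (fun i => (Real.sqrt (p i) : ℂ)) * Uᴴ, ?_⟩
  have hd : Matrix.diagonal (fun i => (p i : ℂ)) =
      (Matrix.diagonal (fun i => (Real.sqrt (p i) : ℂ)))ᴴ *
        Matrix.diagonal (fun i => (Real.sqrt (p i) : ℂ)) := by
    rw [Matrix.diagonal_conjTranspose, Matrix.diagonal_mul_diagonal]
    congr 1
    ext i
    simp only [Pi.star_apply, Complex.star_def, Complex.conj_ofReal]
    rw [← Complex.ofReal_mul, Real.mul_self_sqrt (h.nonneg i)]
  rw [h.eq, hd, Matrix.conjTranspose_mul, Matrix.conjTranspose_conjTranspose]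
  simp only [Matrix.mul_assoc]

/-- The Choi matrix of a channel is positive semidefinite. -/
theorem IsChannel.choi_posSemidef {Φ : Matrix X X ℂ →ₗ[ℂ] Matrix Y Y ℂ} (h : IsChannel Φ) :
    (Matrix.of fun a b : Y × X => Φ (Matrix.single a.2 b.2 1) a.1 b.1).PosSemidef := by
  let e := Fintype.equivFin X
  -- The unnormalized maximally entangled vector. The bijection `e` is needed because complete
  -- positivity is stated for the ancillas `Fin n` only.
  let ω : X × Fin (Fintype.card X) → ℂ := fun a => if e a.1 = a.2 then 1 else 0
  have h1 := (h.1 _ _ (Matrix.posSemidef_vecMulVec_self_star ω)).submatrix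
    (fun a : Y × X => (a.1, e a.2))
  convert h1 using 1
  ext a b
  rw [Matrix.of_apply, Matrix.submatrix_apply]
  change _ = Φ (Matrix.of fun x x' => Matrix.vecMulVec ω (star ω) (x, e a.2) (x', e b.2)) a.1 b.1
  refine congrFun (congrFun (congrArg Φ ?_) a.1) b.1
  ext x x'
  rw [Matrix.of_apply, Matrix.vecMulVec_apply, Pi.star_apply, Matrix.single_apply]
  simp only [ω, e.apply_eq_iff_eq]
  by_cases h2 : x = a.2 <;> by_cases h3 : x' = b.2 <;> simp [h2, h3, eq_comm]

/-- Choi's argument: factor the Choi matrix as `Bᴴ * B` and reshape the conjugated rows of `B` into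
Kraus operators. Trace preservation, tested against all `M`, is the completeness relation. -/
theorem IsChannel.isKraus {Φ : Matrix X X ℂ →ₗ[ℂ] Matrix Y Y ℂ} (h : IsChannel Φ) :
    IsKraus Φ := by
  obtain ⟨B, hB⟩ := exists_eq_conjTranspose_mul_self h.choi_posSemidef
  have hΦ : Φ = krausMap (fun k : Y × X => Matrix.of fun y x => star (B k (y, x))) := by
    refine LinearMap.ext fun M => ?_
    ext y y'
    rw [apply_eq_sum_single, krausMap_apply, Matrix.sum_apply]
    have hC : ∀ x x', Φ (Matrix.single x x' 1) y y' = ∑ k, star (B k (y, x)) * B k (y', x') := by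
      intro x x'
      have := congrFun (congrFun hB (y, x)) (y', x')
      rw [Matrix.of_apply, Matrix.mul_apply] at this
      exact this
    simp only [hC, Matrix.mul_apply, Finset.mul_sum, Finset.sum_mul, Matrix.conjTranspose_apply,
      Matrix.of_apply, star_star]
    rw [Finset.sum_comm]
    refine (Finset.sum_congr rfl fun x' _ => Finset.sum_comm).trans ?_
    rw [Finset.sum_comm]
    refine Finset.sum_congr rfl fun k _ => Finset.sum_congr rfl fun x' _ =>
      Finset.sum_congr rfl fun x _ => ?_
    ring
  refine ⟨Y × X, inferInstance, _, hΦ, ?_⟩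
  refine Matrix.ext_iff_trace_mul_right.2 fun M => ?_
  have h1 := h.2 M
  have h2 := trace_mul_krausMap (fun k : Y × X => Matrix.of fun y x => star (B k (y, x))) M 1
  rw [Matrix.one_mul, ← hΦ, h1] at h2
  rw [Matrix.one_mul, h2, krausMap_apply]
  simp

theorem IsKraus.posSemidef {Φ : Matrix X X ℂ →ₗ[ℂ] Matrix Y Y ℂ} (h : IsKraus Φ)
    {M : Matrix X X ℂ} (hM : M.PosSemidef) : (Φ M).PosSemidef := by
  obtain ⟨ι, _, K, rfl, -⟩ := h
  exact krausMap_posSemidef K hM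

theorem IsKraus.trace {Φ : Matrix X X ℂ →ₗ[ℂ] Matrix Y Y ℂ} (h : IsKraus Φ)
    (M : Matrix X X ℂ) : (Φ M).trace = M.trace := by
  obtain ⟨ι, _, K, rfl, hK⟩ := h
  exact trace_krausMap K hK M

theorem IsKraus.isState {Φ : Matrix X X ℂ →ₗ[ℂ] Matrix Y Y ℂ} (h : IsKraus Φ)
    {M : Matrix X X ℂ} (hM : IsState M) : IsState (Φ M) :=
  ⟨h.posSemidef hM.1, (h.trace M).trans hM.2⟩

theorem IsKraus.relEntropy_le {Φ : Matrix X X ℂ →ₗ[ℂ] Matrix Y Y ℂ} (h : IsKraus Φ)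
    {ρ σ : Matrix X X ℂ} (hρ : ρ.PosSemidef) (hσ : σ.PosSemidef) :
    relEntropy (Φ ρ) (Φ σ) ≤ relEntropy ρ σ := by
  obtain ⟨ι, _, K, rfl, hK⟩ := h
  exact relEntropy_krausMap_le K hK hρ hσ

theorem IsKraus.comp {Λ : Matrix Y Y ℂ →ₗ[ℂ] Matrix Z Z ℂ} {Φ : Matrix X X ℂ →ₗ[ℂ] Matrix Y Y ℂ}
    (hΛ : IsKraus Λ) (hΦ : IsKraus Φ) : IsKraus (Λ ∘ₗ Φ) := by
  obtain ⟨ι, _, L, rfl, hL⟩ := hΛ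
  obtain ⟨κ, _, K, rfl, hK⟩ := hΦ
  refine ⟨ι × κ, inferInstance, fun a => L a.1 * K a.2, ?_, ?_⟩
  · refine LinearMap.ext fun M => ?_
    simp only [LinearMap.comp_apply, krausMap_apply, Fintype.sum_prod_type, Matrix.mul_sum,
      Matrix.sum_mul, Matrix.conjTranspose_mul, Matrix.mul_assoc]
  · rw [Fintype.sum_prod_type, Finset.sum_comm, ← hK]
    refine Finset.sum_congr rfl fun k _ => ?_
    have : ∀ a, (L a * K k)ᴴ * (L a * K k) = (K k)ᴴ * ((L a)ᴴ * L a) * K k := by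
      intro a
      simp only [Matrix.conjTranspose_mul, Matrix.mul_assoc]
    simp only [this]
    rw [← Matrix.sum_mul, ← Matrix.mul_sum, hL, Matrix.mul_one]

theorem ampliate_krausMap {X Y Z ι : Type*} [Fintype X] [Fintype ι] [Fintype Z] [DecidableEq Z]
    (K : ι → Matrix Y X ℂ) :
    ampliate (krausMap K) Z = krausMap (fun k => K k ⊗ₖ (1 : Matrix Z Z ℂ)) := by
  refine LinearMap.ext fun M => ?_
  ext a b
  change (∑ k, K k * Matrix.of (fun x x' => M (x, a.2) (x', b.2)) * (K k)ᴴ) a.1 b.1 = _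
  rw [krausMap_apply, Matrix.sum_apply, Matrix.sum_apply]
  refine Finset.sum_congr rfl fun k _ => ?_
  simp only [Matrix.mul_apply, Fintype.sum_prod_type, Matrix.kroneckerMap_apply,
    Matrix.conjTranspose_apply, Matrix.one_apply, Matrix.of_apply, mul_ite, ite_mul, mul_one,
    mul_zero, zero_mul, Finset.sum_ite_eq, Finset.mem_univ, if_true, apply_ite star, star_zero]

theorem IsKraus.ampliate {Φ : Matrix X X ℂ →ₗ[ℂ] Matrix Y Y ℂ} (h : IsKraus Φ) :
    IsKraus (ampliate Φ Z) := by
  obtain ⟨ι, _, K, rfl, hK⟩ := h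
  refine ⟨ι, inferInstance, _, ampliate_krausMap K, ?_⟩
  have : ∀ k, (K k ⊗ₖ (1 : Matrix Z Z ℂ))ᴴ * (K k ⊗ₖ (1 : Matrix Z Z ℂ)) =
      ((K k)ᴴ * K k) ⊗ₖ (1 : Matrix Z Z ℂ) := by
    intro k
    rw [Matrix.conjTranspose_kronecker, ← Matrix.mul_kronecker_mul, Matrix.conjTranspose_one,
      Matrix.mul_one]
  simp only [this]
  rw [← Matrix.one_kronecker_one, ← hK]
  ext a b
  simp only [Matrix.sum_apply, Matrix.kroneckerMap_apply, Finset.sum_mul]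

/-- Discarding the factor `E` of `S ≃ R × E`. -/
def discard {R E S : Type*} [Fintype E] (g : R × E ≃ S) :
    Matrix S S ℂ →ₗ[ℂ] Matrix R R ℂ where
  toFun M := Matrix.of fun r r' => ∑ e, M (g (r, e)) (g (r', e))
  map_add' M M' := by
    ext r r'
    simp [Finset.sum_add_distrib]
  map_smul' c M := by
    ext r r'
    simp [Finset.mul_sum]

theorem discard_apply {R E S : Type*} [Fintype E] (g : R × E ≃ S) (M : Matrix S S ℂ) (r r' : R) :
    discard g M r r' = ∑ e, M (g (r, e)) (g (r', e)) := rfl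

/-- The Kraus operators are the bras `⟨e|` of the discarded factor. With a one-point `E` this gives
relabellings of the basis, with a one-point `R` the full trace. -/
theorem isKraus_discard {R E S : Type u} [Fintype R] [Fintype E] [Fintype S]
    [DecidableEq S] (g : R × E ≃ S) : IsKraus (discard g) := by
  refine ⟨E, inferInstance, fun e => (1 : Matrix S S ℂ).submatrix (fun r => g (r, e)) id, ?_, ?_⟩
  · refine LinearMap.ext fun M => ?_
    ext r r'
    rw [discard_apply, krausMap_apply, Matrix.sum_apply]
    refine Finset.sum_congr rfl fun e _ => ?_
    simp [Matrix.mul_apply, Matrix.one_apply]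
  · ext s s'
    rw [Matrix.sum_apply, Matrix.one_apply]
    have h1 : ∀ e, (((1 : Matrix S S ℂ).submatrix (fun r => g (r, e)) id)ᴴ *
        (1 : Matrix S S ℂ).submatrix (fun r => g (r, e)) id) s s' =
        ∑ r, if g (r, e) = s ∧ g (r, e) = s' then 1 else 0 := by
      intro e
      rw [Matrix.mul_apply]
      refine Finset.sum_congr rfl fun r _ => ?_
      by_cases h2 : g (r, e) = s <;> by_cases h3 : g (r, e) = s' <;>
        simp [Matrix.one_apply, h2, h3]
    rw [Finset.sum_congr rfl fun e _ => h1 e, Finset.sum_comm,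
      ← Fintype.sum_prod_type' (f := fun r e => if g (r, e) = s ∧ g (r, e) = s' then (1 : ℂ) else 0),
      g.sum_comp (fun a => if a = s ∧ a = s' then (1 : ℂ) else 0)]
    simp [ite_and]

theorem isKraus_traceSnd : IsKraus (traceSnd X Z) := by
  have : traceSnd X Z = discard (Equiv.refl (X × Z)) := by
    refine LinearMap.ext fun M => ?_
    ext x x'
    rw [discard_apply]
    rfl
  rw [this]
  exact isKraus_discard _

theorem relEntropy_submatrix_le (e : X ≃ Y) {ρ σ : Matrix Y Y ℂ} (hρ : ρ.PosSemidef)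
    (hσ : σ.PosSemidef) : relEntropy (ρ.submatrix e e) (σ.submatrix e e) ≤ relEntropy ρ σ := by
  have h : ∀ M : Matrix Y Y ℂ,
      discard ((Equiv.prodPUnit X).trans e : X × PUnit.{u + 1} ≃ Y) M = M.submatrix e e := by
    intro M
    ext x x'
    simp [discard_apply]
  rw [← h, ← h]
  exact (isKraus_discard _).relEntropy_le hρ hσ

/-- The relative entropy is invariant under a relabelling of the basis. -/
theorem relEntropy_submatrix (e : X ≃ Y) {ρ σ : Matrix Y Y ℂ} (hρ : ρ.PosSemidef)
    (hσ : σ.PosSemidef) : relEntropy (ρ.submatrix e e) (σ.submatrix e e) = relEntropy ρ σ := by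
  refine le_antisymm (relEntropy_submatrix_le e hρ hσ) ?_
  have := relEntropy_submatrix_le e.symm (hρ.submatrix e) (hσ.submatrix e)
  simpa using this

end Basic

/-! ### Tensor powers of matrices and maps -/

section TensorPower

/-- The tensor product `K₁ ⊗ ⋯ ⊗ K_N`. -/
def tensorProd {X Y : Type*} {N : ℕ} (K : Fin N → Matrix Y X ℂ) :
    Matrix (Fin N → Y) (Fin N → X) ℂ :=
  Matrix.of fun i j => ∏ t, K t (i t) (j t)

theorem tensorProd_apply {X Y : Type*} {N : ℕ} (K : Fin N → Matrix Y X ℂ) (i : Fin N → Y)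
    (j : Fin N → X) : tensorProd K i j = ∏ t, K t (i t) (j t) := rfl

variable {X Y Z : Type u} [Fintype X] [DecidableEq X] [Fintype Y] [DecidableEq Y]
  [Fintype Z] [DecidableEq Z] {N : ℕ}

theorem mapPow_apply (Φ : Matrix X X ℂ →ₗ[ℂ] Matrix Y Y ℂ)
    (M : Matrix (Fin N → X) (Fin N → X) ℂ) (i j : Fin N → Y) :
    mapPow N Φ M i j =
      ∑ k, ∑ l, M k l * ∏ t, Φ (Matrix.single (k t) (l t) 1) (i t) (j t) := rfl

theorem mapPow_tensorProd (Φ : Matrix X X ℂ →ₗ[ℂ] Matrix Y Y ℂ) (M : Fin N → Matrix X X ℂ) :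
    mapPow N Φ (tensorProd M) = tensorProd fun t => Φ (M t) := by
  ext i j
  rw [mapPow_apply, tensorProd_apply]
  simp only [apply_eq_sum_single Φ (M _), tensorProd_apply, Finset.prod_univ_sum,
    Fintype.piFinset_univ, ← Finset.prod_mul_distrib]

theorem mapPow_tensorPow (Φ : Matrix X X ℂ →ₗ[ℂ] Matrix Y Y ℂ) (M : Matrix X X ℂ) :
    mapPow N Φ (tensorPow N M) = tensorPow N (Φ M) :=
  mapPow_tensorProd Φ fun _ => M

theorem single_eq_tensorProd (k l : Fin N → X) :
    Matrix.single k l (1 : ℂ) = tensorProd fun t => Matrix.single (k t) (l t) (1 : ℂ) := by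
  ext i j
  rw [tensorProd_apply, Matrix.single_apply]
  simp only [Matrix.single_apply]
  rw [Fintype.prod_ite_zero]
  simp [funext_iff, forall_and]

/-- Matrix units of the tensor power are product matrices, on which the powers act factor by factor;
linearity does the rest. -/
theorem mapPow_comp (Λ : Matrix Y Y ℂ →ₗ[ℂ] Matrix Z Z ℂ) (Φ : Matrix X X ℂ →ₗ[ℂ] Matrix Y Y ℂ) :
    mapPow N (Λ ∘ₗ Φ) = mapPow N Λ ∘ₗ mapPow N Φ := by
  refine LinearMap.ext fun M => ?_
  ext i j
  rw [apply_eq_sum_single, apply_eq_sum_single (mapPow N Λ ∘ₗ mapPow N Φ)]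
  refine Finset.sum_congr rfl fun k _ => Finset.sum_congr rfl fun l _ => ?_
  rw [LinearMap.comp_apply, single_eq_tensorProd, mapPow_tensorProd, mapPow_tensorProd,
    mapPow_tensorProd]
  rfl

/-- Expanding a product of sums over Kraus indices gives a sum over strings of indices, one index
per copy. -/
theorem mapPow_krausMap {ι : Type*} [Fintype ι] (K : ι → Matrix Y X ℂ) :
    mapPow N (krausMap K) = krausMap fun e : Fin N → ι => tensorProd fun t => K (e t) := by
  have hs : ∀ (k l : X) (i j : Y), krausMap K (Matrix.single k l 1) i j =
      ∑ a, K a i k * star (K a j l) := by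
    intro k l i j
    rw [krausMap_apply, Matrix.sum_apply]
    refine Finset.sum_congr rfl fun a _ => ?_
    simp [Matrix.mul_apply, Matrix.single_apply, ite_and]
  refine LinearMap.ext fun M => ?_
  ext i j
  rw [mapPow_apply, krausMap_apply, Matrix.sum_apply]
  simp only [hs, Finset.prod_univ_sum, Fintype.piFinset_univ, Matrix.mul_apply, Finset.mul_sum,
    Finset.sum_mul, Matrix.conjTranspose_apply, tensorProd_apply, star_prod,
    Finset.prod_mul_distrib]
  rw [Finset.sum_comm]
  refine (Finset.sum_congr rfl fun x' _ => Finset.sum_comm).trans ?_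
  rw [Finset.sum_comm]
  refine Finset.sum_congr rfl fun k _ => Finset.sum_congr rfl fun x' _ =>
    Finset.sum_congr rfl fun x _ => ?_
  ring

theorem sum_tensorProd_star_mul {ι : Type*} [Fintype ι] (K : ι → Matrix Y X ℂ)
    (hK : ∑ k, (K k)ᴴ * K k = 1) :
    ∑ e : Fin N → ι, (tensorProd fun t => K (e t))ᴴ * (tensorProd fun t => K (e t)) = 1 := by
  have hij : ∀ x x', ∑ a, ∑ y, star (K a y x) * K a y x' = (1 : Matrix X X ℂ) x x' := by
    intro x x'
    rw [← hK, Matrix.sum_apply]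
    rfl
  ext i j
  simp only [Matrix.sum_apply, Matrix.mul_apply, Matrix.conjTranspose_apply, tensorProd_apply,
    star_prod, ← Finset.prod_mul_distrib]
  have h1 : ∀ e : Fin N → ι, ∑ y : Fin N → Y, ∏ t, star (K (e t) (y t) (i t)) * K (e t) (y t) (j t)
      = ∏ t, ∑ y, star (K (e t) y (i t)) * K (e t) y (j t) := by
    intro e
    rw [Finset.prod_univ_sum, Fintype.piFinset_univ]
  simp only [h1]
  have h2 := Finset.prod_univ_sum (fun _ : Fin N => (Finset.univ : Finset ι))
    (fun t a => ∑ y, star (K a y (i t)) * K a y (j t))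
  rw [Fintype.piFinset_univ] at h2
  rw [← h2]
  simp only [hij, Matrix.one_apply]
  rw [Fintype.prod_ite_zero]
  simp [funext_iff]

theorem IsKraus.mapPow {Φ : Matrix X X ℂ →ₗ[ℂ] Matrix Y Y ℂ} (h : IsKraus Φ) :
    IsKraus (mapPow N Φ) := by
  obtain ⟨ι, _, K, rfl, hK⟩ := h
  exact ⟨Fin N → ι, inferInstance, _, mapPow_krausMap K, sum_tensorProd_star_mul K hK⟩

theorem tensorPow_posSemidef {M : Matrix X X ℂ} (hM : M.PosSemidef) :
    (tensorPow N M).PosSemidef := by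
  obtain ⟨B, rfl⟩ := exists_eq_conjTranspose_mul_self hM
  have : tensorPow N (Bᴴ * B) = (tensorProd fun _ : Fin N => B)ᴴ * tensorProd fun _ => B := by
    ext i j
    simp only [tensorPow, Matrix.of_apply, Matrix.mul_apply, Finset.prod_univ_sum,
      Fintype.piFinset_univ, Matrix.conjTranspose_apply, tensorProd_apply, star_prod,
      Finset.prod_mul_distrib]
  rw [this]
  exact Matrix.posSemidef_conjTranspose_mul_self _

theorem trace_tensorPow (M : Matrix X X ℂ) : (tensorPow N M).trace = M.trace ^ N := by
  have := Finset.prod_univ_sum (fun _ : Fin N => (Finset.univ : Finset X)) (fun _ x => M x x)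
  rw [Fintype.piFinset_univ, Finset.prod_const, Finset.card_univ, Fintype.card_fin] at this
  exact this.symm

end TensorPower

end Channels

/-! ### Maps acting on one tensor factor -/

section Ampliation

theorem ampliate_apply {X Y Z : Type*} (Φ : Matrix X X ℂ →ₗ[ℂ] Matrix Y Y ℂ)
    (M : Matrix (X × Z) (X × Z) ℂ) (a b : Y × Z) :
    ampliate Φ Z M a b = Φ (Matrix.of fun x x' => M (x, a.2) (x', b.2)) a.1 b.1 := rfl

theorem ampliate_comp {X Y Y' : Type*} (Λ : Matrix Y Y ℂ →ₗ[ℂ] Matrix Y' Y' ℂ)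
    (Φ : Matrix X X ℂ →ₗ[ℂ] Matrix Y Y ℂ) (Z : Type*) :
    ampliate (Λ ∘ₗ Φ) Z = ampliate Λ Z ∘ₗ ampliate Φ Z := rfl

theorem ampliate_kronecker {X Y Z : Type*} (Φ : Matrix X X ℂ →ₗ[ℂ] Matrix Y Y ℂ)
    (M : Matrix X X ℂ) (P : Matrix Z Z ℂ) : ampliate Φ Z (M ⊗ₖ P) = Φ M ⊗ₖ P := by
  ext a b
  have : (Matrix.of fun x x' => (M ⊗ₖ P) (x, a.2) (x', b.2)) = P a.2 b.2 • M := by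
    ext x x'
    simp [mul_comm]
  rw [ampliate_apply, this, map_smul, Matrix.smul_apply, Matrix.kroneckerMap_apply, smul_eq_mul,
    mul_comm]

theorem traceFst_ampliate {X Y Z : Type u} [Fintype X] [DecidableEq X] [Fintype Y]
    [DecidableEq Y] {Φ : Matrix X X ℂ →ₗ[ℂ] Matrix Y Y ℂ} (hΦ : IsKraus Φ)
    (M : Matrix (X × Z) (X × Z) ℂ) : traceFst (ampliate Φ Z M) = traceFst M := by
  ext z z'
  exact hΦ.trace (Matrix.of fun x x' => M (x, z) (x', z'))

theorem trace_traceFst {X Z : Type*} [Fintype X] [Fintype Z] (M : Matrix (X × Z) (X × Z) ℂ) :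
    (traceFst M).trace = M.trace := by
  simp only [Matrix.trace, Matrix.diag_apply, traceFst, Matrix.of_apply, Fintype.sum_prod_type]
  exact Finset.sum_comm

theorem traceFst_posSemidef {X Z : Type u} [Fintype X] [DecidableEq X] [Fintype Z]
    [DecidableEq Z] {M : Matrix (X × Z) (X × Z) ℂ} (hM : M.PosSemidef) :
    (traceFst M).PosSemidef :=
  (isKraus_discard (Equiv.prodComm Z X)).posSemidef hM

end Ampliation

/-! ### Couplings, probed states and data processing on the final region -/

section Coupling

variable {A Abar B Bbar W : Type u}
  [Fintype A] [DecidableEq A] [Fintype Abar] [DecidableEq Abar]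
  [Fintype B] [DecidableEq B] [Fintype Bbar] [DecidableEq Bbar]
  [Fintype W] [DecidableEq W] {N : ℕ}

/-- Regrouping `(A Abar)^N W` as `(A^N W) Abar^N`. -/
def regroup (A Abar W : Type*) (N : ℕ) :
    (Fin N → A × Abar) × W ≃ ((Fin N → A) × W) × (Fin N → Abar) where
  toFun p := ((fun t => (p.1 t).1, p.2), fun t => (p.1 t).2)
  invFun p := (fun t => (p.1.1 t, p.2 t), p.1.2)
  left_inv _ := rfl
  right_inv _ := rfl

/-- Up to a permutation of tensor factors the extension is `V ⊗ 1`, so its algebraic properties are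
inherited from the Kronecker product. -/
theorem extendCoupling_eq_submatrix (V : Matrix ((Fin N → A) × W) ((Fin N → A) × W) ℂ) :
    extendCoupling Abar V = (V ⊗ₖ (1 : Matrix (Fin N → Abar) (Fin N → Abar) ℂ)).submatrix
      (regroup A Abar W N) (regroup A Abar W N) := by
  ext p q
  simp [extendCoupling, regroup, Matrix.one_apply]

theorem extendCoupling_mul (V V' : Matrix ((Fin N → A) × W) ((Fin N → A) × W) ℂ) :
    extendCoupling Abar (V * V') = extendCoupling Abar V * extendCoupling Abar V' := by
  simp only [extendCoupling_eq_submatrix]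
  rw [Matrix.submatrix_mul_equiv, ← Matrix.mul_kronecker_mul, Matrix.mul_one]

theorem extendCoupling_one :
    extendCoupling Abar (1 : Matrix ((Fin N → A) × W) ((Fin N → A) × W) ℂ) = 1 := by
  rw [extendCoupling_eq_submatrix, Matrix.one_kronecker_one, Matrix.submatrix_one_equiv]

theorem extendCoupling_conjTranspose (V : Matrix ((Fin N → A) × W) ((Fin N → A) × W) ℂ) :
    extendCoupling Abar Vᴴ = (extendCoupling Abar V)ᴴ := by
  simp only [extendCoupling_eq_submatrix, Matrix.conjTranspose_submatrix,
    Matrix.conjTranspose_kronecker, Matrix.conjTranspose_one]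

theorem extendCoupling_mem_unitaryGroup {V : Matrix ((Fin N → A) × W) ((Fin N → A) × W) ℂ}
    (hV : V ∈ Matrix.unitaryGroup ((Fin N → A) × W) ℂ) :
    extendCoupling Abar V ∈ Matrix.unitaryGroup ((Fin N → A × Abar) × W) ℂ := by
  rw [Matrix.mem_unitaryGroup_iff] at hV ⊢
  rw [Matrix.star_eq_conjTranspose] at hV ⊢
  rw [← extendCoupling_conjTranspose, ← extendCoupling_mul, hV, extendCoupling_one]

theorem coupledState_posSemidef {ρ : Matrix (A × Abar) (A × Abar) ℂ} (hρ : ρ.PosSemidef)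
    (ψ : W → ℂ) (V : Matrix ((Fin N → A) × W) ((Fin N → A) × W) ℂ) :
    (coupledState N ρ ψ V).PosSemidef :=
  ((tensorPow_posSemidef hρ).kronecker
    (Matrix.posSemidef_vecMulVec_self_star ψ)).mul_mul_conjTranspose_same _

theorem coupledState_isState {ρ : Matrix (A × Abar) (A × Abar) ℂ} (hρ : IsState ρ)
    {ψ : W → ℂ} (hψ : ∑ w, ‖ψ w‖ ^ 2 = 1)
    {V : Matrix ((Fin N → A) × W) ((Fin N → A) × W) ℂ}
    (hV : V ∈ Matrix.unitaryGroup ((Fin N → A) × W) ℂ) : IsState (coupledState N ρ ψ V) := by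
  refine ⟨coupledState_posSemidef hρ.1 ψ V, ?_⟩
  have h1 := Matrix.mem_unitaryGroup_iff'.1 (extendCoupling_mem_unitaryGroup (Abar := Abar) hV)
  rw [Matrix.star_eq_conjTranspose] at h1
  have h2 : (Matrix.vecMulVec ψ (star ψ)).trace = 1 := by
    rw [Matrix.trace_vecMulVec, dotProduct]
    have : ∀ w, ψ w * star ψ w = ((‖ψ w‖ ^ 2 : ℝ) : ℂ) := by
      intro w
      rw [Pi.star_apply, ← starRingEnd_apply, Complex.mul_conj']
      norm_cast
    simp only [this, ← Complex.ofReal_sum, hψ, Complex.ofReal_one]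
  rw [coupledState, Matrix.trace_mul_comm, ← Matrix.mul_assoc, h1, Matrix.one_mul,
    Matrix.trace_kronecker, trace_tensorPow, hρ.2, h2, one_pow, one_mul]

theorem IsChannel.isKraus_evolveTo
    {𝓔 : Matrix (A × Abar) (A × Abar) ℂ →ₗ[ℂ] Matrix (B × Bbar) (B × Bbar) ℂ}
    (h : IsChannel 𝓔) : IsKraus (evolveTo 𝓔) :=
  isKraus_traceSnd.comp h.isKraus

theorem connectedState_posSemidef {ρ : Matrix (A × Abar) (A × Abar) ℂ} (hρ : ρ.PosSemidef)
    {𝓔 : Matrix (A × Abar) (A × Abar) ℂ →ₗ[ℂ] Matrix (B × Bbar) (B × Bbar) ℂ}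
    (h𝓔 : IsKraus (evolveTo 𝓔)) (ψ : W → ℂ)
    (V : Matrix ((Fin N → A) × W) ((Fin N → A) × W) ℂ) :
    (connectedState N ρ 𝓔 ψ V).PosSemidef :=
  h𝓔.mapPow.ampliate.posSemidef (coupledState_posSemidef hρ ψ V)

theorem connectedState_isState {ρ : Matrix (A × Abar) (A × Abar) ℂ} (hρ : IsState ρ)
    {𝓔 : Matrix (A × Abar) (A × Abar) ℂ →ₗ[ℂ] Matrix (B × Bbar) (B × Bbar) ℂ}
    (h𝓔 : IsKraus (evolveTo 𝓔)) {ψ : W → ℂ} (hψ : ∑ w, ‖ψ w‖ ^ 2 = 1)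
    {V : Matrix ((Fin N → A) × W) ((Fin N → A) × W) ℂ}
    (hV : V ∈ Matrix.unitaryGroup ((Fin N → A) × W) ℂ) : IsState (connectedState N ρ 𝓔 ψ V) :=
  h𝓔.mapPow.ampliate.isState (coupledState_isState hρ hψ hV)

/-- `S(ρ_{B^N W} | τ^{⊗ N} ⊗ ρ_W)` for a given coupling `V` to an ancilla in the state `ψ`. -/
def probeEntropy (N : ℕ) (ρ : Matrix (A × Abar) (A × Abar) ℂ) (τ : Matrix B B ℂ)
    (𝓔 : Matrix (A × Abar) (A × Abar) ℂ →ₗ[ℂ] Matrix (B × Bbar) (B × Bbar) ℂ) (ψ : W → ℂ)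
    (V : Matrix ((Fin N → A) × W) ((Fin N → A) × W) ℂ) : EReal :=
  relEntropy (connectedState N ρ 𝓔 ψ V)
    (tensorPow N τ ⊗ₖ traceFst (connectedState N ρ 𝓔 ψ V))

/-- Data processing for `Λ^{⊗ N} ⊗ id_W`: it maps the joint state to the joint state and, since it
preserves the marginal on `W`, the product reference to the product reference. -/
theorem probeEntropy_le_of_evolveTo_eq_comp {B' Bbar' : Type u} [Fintype B'] [DecidableEq B']
    [Fintype Bbar'] [DecidableEq Bbar']
    {ρ : Matrix (A × Abar) (A × Abar) ℂ} (hρ : ρ.PosSemidef) {τ : Matrix B B ℂ}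
    (hτ : τ.PosSemidef)
    {𝓔 : Matrix (A × Abar) (A × Abar) ℂ →ₗ[ℂ] Matrix (B × Bbar) (B × Bbar) ℂ}
    {𝓔' : Matrix (A × Abar) (A × Abar) ℂ →ₗ[ℂ] Matrix (B' × Bbar') (B' × Bbar') ℂ}
    (h𝓔 : IsKraus (evolveTo 𝓔)) {Λ : Matrix B B ℂ →ₗ[ℂ] Matrix B' B' ℂ} (hΛ : IsKraus Λ)
    (h : evolveTo 𝓔' = Λ ∘ₗ evolveTo 𝓔) (ψ : W → ℂ)
    (V : Matrix ((Fin N → A) × W) ((Fin N → A) × W) ℂ) :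
    probeEntropy N ρ (Λ τ) 𝓔' ψ V ≤ probeEntropy N ρ τ 𝓔 ψ V := by
  have hc : connectedState N ρ 𝓔' ψ V =
      ampliate (mapPow N Λ) W (connectedState N ρ 𝓔 ψ V) := by
    rw [connectedState, h, mapPow_comp, ampliate_comp]
    rfl
  have hpos := connectedState_posSemidef (N := N) hρ h𝓔 ψ V
  rw [probeEntropy, probeEntropy, hc, traceFst_ampliate hΛ.mapPow, ← mapPow_tensorPow,
    ← ampliate_kronecker]
  exact hΛ.mapPow.ampliate.relEntropy_le hpos
    ((tensorPow_posSemidef hτ).kronecker (traceFst_posSemidef hpos))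

end Coupling

/-! ### Suprema over probes; monotonicity in the final region -/

section Suprema

variable {A Abar B Bbar : Type u}
  [Fintype A] [DecidableEq A] [Fintype Abar] [DecidableEq Abar]
  [Fintype B] [DecidableEq B] [Fintype Bbar] [DecidableEq Bbar]

/-- The supremum of `probeEntropy` over all couplings to an ancilla. -/
def probeSup (N : ℕ) (ρ : Matrix (A × Abar) (A × Abar) ℂ) (τ : Matrix B B ℂ)
    (𝓔 : Matrix (A × Abar) (A × Abar) ℂ →ₗ[ℂ] Matrix (B × Bbar) (B × Bbar) ℂ) : EReal :=
  ⨆ (W : Type u) (_ : Fintype W) (_ : DecidableEq W) (ψ : W → ℂ) (_ : ∑ w, ‖ψ w‖ ^ 2 = 1)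
      (V : Matrix.unitaryGroup ((Fin N → A) × W) ℂ), probeEntropy N ρ τ 𝓔 ψ V.1

theorem probeEntropy_le_probeSup {W : Type u} [Fintype W] [DecidableEq W] (N : ℕ)
    (ρ : Matrix (A × Abar) (A × Abar) ℂ) (τ : Matrix B B ℂ)
    (𝓔 : Matrix (A × Abar) (A × Abar) ℂ →ₗ[ℂ] Matrix (B × Bbar) (B × Bbar) ℂ) {ψ : W → ℂ}
    (hψ : ∑ w, ‖ψ w‖ ^ 2 = 1) (V : Matrix.unitaryGroup ((Fin N → A) × W) ℂ) :
    probeEntropy N ρ τ 𝓔 ψ V.1 ≤ probeSup N ρ τ 𝓔 :=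
  le_iSup_of_le W <| le_iSup_of_le _ <| le_iSup_of_le _ <| le_iSup_of_le ψ <|
    le_iSup_of_le hψ <| le_iSup_of_le V le_rfl

theorem probeSup_le {N : ℕ} {ρ : Matrix (A × Abar) (A × Abar) ℂ} {τ : Matrix B B ℂ}
    {𝓔 : Matrix (A × Abar) (A × Abar) ℂ →ₗ[ℂ] Matrix (B × Bbar) (B × Bbar) ℂ} {c : EReal}
    (h : ∀ (W : Type u) [Fintype W] [DecidableEq W] (ψ : W → ℂ), ∑ w, ‖ψ w‖ ^ 2 = 1 →
      ∀ V : Matrix.unitaryGroup ((Fin N → A) × W) ℂ, probeEntropy N ρ τ 𝓔 ψ V.1 ≤ c) :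
    probeSup N ρ τ 𝓔 ≤ c :=
  iSup_le fun W => iSup_le fun _ => iSup_le fun _ => iSup_le fun ψ => iSup_le fun hψ =>
    iSup_le fun V => h W ψ hψ V

theorem exists_lt_probeEntropy {N : ℕ} {ρ : Matrix (A × Abar) (A × Abar) ℂ} {τ : Matrix B B ℂ}
    {𝓔 : Matrix (A × Abar) (A × Abar) ℂ →ₗ[ℂ] Matrix (B × Bbar) (B × Bbar) ℂ} {c : EReal}
    (h : c < probeSup N ρ τ 𝓔) :
    ∃ (W : Type u) (_ : Fintype W) (_ : DecidableEq W) (ψ : W → ℂ) (_ : ∑ w, ‖ψ w‖ ^ 2 = 1)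
      (V : Matrix.unitaryGroup ((Fin N → A) × W) ℂ), c < probeEntropy N ρ τ 𝓔 ψ V.1 := by
  simpa only [probeSup, lt_iSup_iff] using h

theorem optimalRate_le_of_probeSup_le {A' Abar' B' Bbar' : Type u}
    [Fintype A'] [DecidableEq A'] [Fintype Abar'] [DecidableEq Abar']
    [Fintype B'] [DecidableEq B'] [Fintype Bbar'] [DecidableEq Bbar'] {N : ℕ}
    {ρ : Matrix (A × Abar) (A × Abar) ℂ} {τ : Matrix B B ℂ}
    {𝓔 : Matrix (A × Abar) (A × Abar) ℂ →ₗ[ℂ] Matrix (B × Bbar) (B × Bbar) ℂ}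
    {ρ' : Matrix (A' × Abar') (A' × Abar') ℂ} {τ' : Matrix B' B' ℂ}
    {𝓔' : Matrix (A' × Abar') (A' × Abar') ℂ →ₗ[ℂ] Matrix (B' × Bbar') (B' × Bbar') ℂ}
    (h : probeSup N ρ τ 𝓔 ≤ probeSup N ρ' τ' 𝓔') :
    optimalRate N ρ τ 𝓔 ≤ optimalRate N ρ' τ' 𝓔' :=
  EReal.div_le_div_right_of_nonneg (by positivity) h

/-- Only the evolution reduced to the final region matters, so one statement covers both a channel
on `B` and the restriction from `BD` to `B`. -/
theorem stmiN_le_of_evolveTo_eq_comp {B' Bbar' : Type u} [Fintype B'] [DecidableEq B']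
    [Fintype Bbar'] [DecidableEq Bbar']
    {ρ : Matrix (A × Abar) (A × Abar) ℂ} (hρ : ρ.PosSemidef)
    {𝓔 : Matrix (A × Abar) (A × Abar) ℂ →ₗ[ℂ] Matrix (B × Bbar) (B × Bbar) ℂ}
    {𝓔' : Matrix (A × Abar) (A × Abar) ℂ →ₗ[ℂ] Matrix (B' × Bbar') (B' × Bbar') ℂ}
    (h𝓔 : IsKraus (evolveTo 𝓔)) {Λ : Matrix B B ℂ →ₗ[ℂ] Matrix B' B' ℂ} (hΛ : IsKraus Λ)
    (h : evolveTo 𝓔' = Λ ∘ₗ evolveTo 𝓔) (N : ℕ) : stmiN N ρ 𝓔' ≤ stmiN N ρ 𝓔 := by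
  refine optimalRate_le_of_probeSup_le (probeSup_le fun W _ _ ψ hψ V => ?_)
  rw [h]
  exact (probeEntropy_le_of_evolveTo_eq_comp hρ (h𝓔.posSemidef hρ) h𝓔 hΛ h ψ V.1).trans
    (probeEntropy_le_probeSup N ρ _ 𝓔 hψ V)

theorem evolveTo_ampliate_comp {B' : Type u} [Fintype B'] [DecidableEq B']
    (𝓔 : Matrix (A × Abar) (A × Abar) ℂ →ₗ[ℂ] Matrix (B × Bbar) (B × Bbar) ℂ)
    (Φ : Matrix B B ℂ →ₗ[ℂ] Matrix B' B' ℂ) :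
    evolveTo (ampliate Φ Bbar ∘ₗ 𝓔) = Φ ∘ₗ evolveTo 𝓔 := by
  refine LinearMap.ext fun M => ?_
  ext b b'
  have h : evolveTo 𝓔 M = ∑ z, Matrix.of fun x x' => 𝓔 M (x, z) (x', z) := by
    ext x x'
    simp [evolveTo, traceSnd, Matrix.sum_apply]
  rw [LinearMap.comp_apply, h, map_sum, Matrix.sum_apply]
  rfl

theorem evolveTo_assoc_comp {D R : Type u} [Fintype D] [DecidableEq D] [Fintype R]
    [DecidableEq R]
    (𝓔 : Matrix (A × Abar) (A × Abar) ℂ →ₗ[ℂ] Matrix ((B × D) × R) ((B × D) × R) ℂ) :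
    evolveTo ((assoc B D R).toLinearMap ∘ₗ 𝓔) = traceSnd B D ∘ₗ evolveTo 𝓔 := by
  refine LinearMap.ext fun M => ?_
  ext b b'
  change ∑ z : D × R, 𝓔 M ((b, z.1), z.2) ((b', z.1), z.2) =
    ∑ d, ∑ r, 𝓔 M ((b, d), r) ((b', d), r)
  rw [Fintype.sum_prod_type]

end Suprema

/-! ### Monotonicity in the initial region -/

section Enlarge

variable {A C R B Bbar : Type u} [Fintype A] [DecidableEq A] [Fintype C] [DecidableEq C]
  [Fintype R] [DecidableEq R] [Fintype B] [DecidableEq B] [Fintype Bbar] [DecidableEq Bbar]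
  {N : ℕ}

theorem mapPow_submatrix {X Y : Type u} [Fintype X] [DecidableEq X] [Fintype Y] [DecidableEq Y]
    {Φ : Matrix X X ℂ →ₗ[ℂ] Matrix Y Y ℂ} {e : Y → X} (h : ∀ M, Φ M = M.submatrix e e)
    (M : Matrix (Fin N → X) (Fin N → X) ℂ) :
    mapPow N Φ M = M.submatrix (fun i t => e (i t)) (fun i t => e (i t)) := by
  ext i j
  rw [mapPow_apply]
  have : ∀ k l : Fin N → X, ∏ t, Φ (Matrix.single (k t) (l t) 1) (i t) (j t) =
      Matrix.single k l (1 : ℂ) (fun t => e (i t)) (fun t => e (j t)) := by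
    intro k l
    rw [single_eq_tensorProd, tensorProd_apply]
    simp only [h, Matrix.submatrix_apply]
  simp only [this, Matrix.single_apply, Matrix.submatrix_apply]
  simp [ite_and]

/-- Whether `C` counts as part of the complement or as a part of the region on which the coupling is
trivial, the operator on the whole system is the same up to reassociation. -/
theorem connectedState_assoc {W : Type u} [Fintype W] [DecidableEq W]
    (ρ : Matrix ((A × C) × R) ((A × C) × R) ℂ)
    (𝓔 : Matrix ((A × C) × R) ((A × C) × R) ℂ →ₗ[ℂ] Matrix (B × Bbar) (B × Bbar) ℂ) (ψ : W → ℂ)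
    (V : Matrix ((Fin N → A) × W) ((Fin N → A) × W) ℂ) :
    connectedState N (assoc A C R ρ) (𝓔 ∘ₗ (assoc A C R).symm.toLinearMap) ψ V =
      connectedState N ρ 𝓔 ψ (extendCoupling C V) := by
  let f : (Fin N → (A × C) × R) × W ≃ (Fin N → A × (C × R)) × W :=
    (Equiv.piCongrRight fun _ => Equiv.prodAssoc A C R).prodCongr (Equiv.refl W)
  have hV : (extendCoupling (C × R) V).submatrix f f = extendCoupling R (extendCoupling C V) := by
    ext p q
    simp only [extendCoupling, Matrix.submatrix_apply, Matrix.of_apply, mul_assoc]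
    congr 1
    simp only [f, funext_iff, Prod.ext_iff]
    simp [forall_and, ← ite_and, and_comm]
  have hρ : (tensorPow N (assoc A C R ρ) ⊗ₖ Matrix.vecMulVec ψ (star ψ)).submatrix f f =
      tensorPow N ρ ⊗ₖ Matrix.vecMulVec ψ (star ψ) := by
    ext p q
    simp [tensorPow, f, assoc]
  have hc : (coupledState N (assoc A C R ρ) ψ V).submatrix f f =
      coupledState N ρ ψ (extendCoupling C V) := by
    rw [coupledState, coupledState, ← hV, ← hρ, Matrix.conjTranspose_submatrix,
      Matrix.submatrix_mul_equiv, Matrix.submatrix_mul_equiv]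
  have he : evolveTo (𝓔 ∘ₗ (assoc A C R).symm.toLinearMap) =
      evolveTo 𝓔 ∘ₗ (assoc A C R).symm.toLinearMap := rfl
  rw [connectedState, connectedState, he, mapPow_comp, ampliate_comp, ← hc, LinearMap.comp_apply]
  congr 1
  ext a b
  rw [ampliate_apply, mapPow_submatrix (e := Equiv.prodAssoc A C R) fun M => rfl]
  rfl

/-- The couplings at `A` form a subset of those at `AC`, with the same reference state. -/
theorem stmiN_assoc_le (ρ : Matrix ((A × C) × R) ((A × C) × R) ℂ)
    (𝓔 : Matrix ((A × C) × R) ((A × C) × R) ℂ →ₗ[ℂ] Matrix (B × Bbar) (B × Bbar) ℂ) (N : ℕ) :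
    stmiN N (assoc A C R ρ) (𝓔 ∘ₗ (assoc A C R).symm.toLinearMap) ≤ stmiN N ρ 𝓔 := by
  refine optimalRate_le_of_probeSup_le (probeSup_le fun W _ _ ψ hψ V => ?_)
  have h1 : evolveTo (𝓔 ∘ₗ (assoc A C R).symm.toLinearMap) (assoc A C R ρ) = evolveTo 𝓔 ρ := by
    change evolveTo 𝓔 ((assoc A C R).symm (assoc A C R ρ)) = _
    rw [LinearEquiv.symm_apply_apply]
  rw [probeEntropy, connectedState_assoc, h1]
  exact probeEntropy_le_probeSup N ρ _ 𝓔 hψ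
    ⟨extendCoupling C V.1, extendCoupling_mem_unitaryGroup V.2⟩

end Enlarge

/-! ### Unitary dilations and discarding part of the ancilla -/

section Dilation

/-- **Stinespring dilation**: Kraus operators are the blocks of a unitary. -/
theorem exists_unitary_of_kraus {X E : Type*} [Fintype X] [DecidableEq X] [Fintype E]
    [DecidableEq E] (K : E → Matrix X X ℂ) (hK : ∑ k, (K k)ᴴ * K k = 1) (e₀ : E) :
    ∃ U ∈ Matrix.unitaryGroup (X × E) ℂ, ∀ x e x', U (x, e) (x', e₀) = K e x x' := by
  let v : X × E → EuclideanSpace ℂ (X × E) := fun b => WithLp.toLp 2 fun a => K a.2 a.1 b.1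
  let s : Set (X × E) := {b | b.2 = e₀}
  -- The columns prescribed by `K`, those with label `e₀`, are orthonormal by the completeness
  -- relation; any extension to an orthonormal basis supplies the other columns.
  have hv : Orthonormal ℂ (s.domRestrict v) := by
    rw [orthonormal_iff_ite]
    rintro ⟨⟨x, e⟩, he⟩ ⟨⟨x', e'⟩, he'⟩
    obtain rfl : e = e₀ := he
    obtain rfl : e' = e := he'
    have h1 := congrFun (congrFun hK x) x'
    rw [Matrix.sum_apply, Matrix.one_apply] at h1
    simp only [Subtype.mk.injEq, Prod.mk.injEq, and_true]
    rw [← h1, PiLp.inner_apply, Fintype.sum_prod_type, Finset.sum_comm]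
    refine Finset.sum_congr rfl fun k _ => ?_
    rw [Matrix.mul_apply]
    refine Finset.sum_congr rfl fun y _ => ?_
    simp [v, mul_comm]
  obtain ⟨b, hb⟩ := hv.exists_orthonormalBasis_extension_of_card_eq
    (ι := X × E) (by rw [finrank_euclideanSpace])
  refine ⟨Matrix.of fun a c => b c a, ?_, ?_⟩
  · rw [Matrix.mem_unitaryGroup_iff']
    ext c c'
    rw [Matrix.one_apply, ← orthonormal_iff_ite.1 b.orthonormal c c', Matrix.mul_apply,
      PiLp.inner_apply]
    refine Finset.sum_congr rfl fun a _ => ?_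
    simp [Matrix.star_apply, mul_comm]
  · intro x e x'
    rw [Matrix.of_apply, hb (x', e₀) rfl]

theorem submatrix_mem_unitaryGroup {X Y : Type*} [Fintype X] [DecidableEq X] [Fintype Y]
    [DecidableEq Y] {U : Matrix Y Y ℂ} (hU : U ∈ Matrix.unitaryGroup Y ℂ) (e : X ≃ Y) :
    U.submatrix e e ∈ Matrix.unitaryGroup X ℂ := by
  rw [Matrix.mem_unitaryGroup_iff, Matrix.star_eq_conjTranspose] at hU ⊢
  rw [Matrix.conjTranspose_submatrix, Matrix.submatrix_mul_equiv, hU, Matrix.submatrix_one_equiv]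

/-- Isolating the factor `E` of `X (E W)`. -/
def isolate (X E W : Type*) : (X × W) × E ≃ X × (E × W) where
  toFun a := (a.1.1, (a.2, a.1.2))
  invFun a := ((a.1, a.2.2), a.2.1)
  left_inv _ := rfl
  right_inv _ := rfl

/-- A unitary that first acts as `∑ₑ |e⟩ ⊗ Kₑ` on `X` and the initial state `e₀` of `E`, then as
`V` on `X W`. -/
theorem exists_unitary_dilation {X E W : Type*} [Fintype X] [DecidableEq X] [Fintype E]
    [DecidableEq E] [Fintype W] [DecidableEq W] (K : E → Matrix X X ℂ)
    (hK : ∑ k, (K k)ᴴ * K k = 1) (e₀ : E) {V : Matrix (X × W) (X × W) ℂ}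
    (hV : V ∈ Matrix.unitaryGroup (X × W) ℂ) :
    ∃ V' ∈ Matrix.unitaryGroup (X × (E × W)) ℂ, ∀ x e w x' w',
      V' (x, (e, w)) (x', (e₀, w')) = ∑ y, V (x, w) (y, w') * K e y x' := by
  obtain ⟨U, hU, hUK⟩ := exists_unitary_of_kraus K hK e₀
  refine ⟨(V ⊗ₖ (1 : Matrix E E ℂ)).submatrix (isolate X E W).symm (isolate X E W).symm *
    (U ⊗ₖ (1 : Matrix W W ℂ)).submatrix (Equiv.prodAssoc X E W).symm
      (Equiv.prodAssoc X E W).symm, ?_, ?_⟩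
  · exact mul_mem
      (submatrix_mem_unitaryGroup (Matrix.kronecker_mem_unitary hV (one_mem _)) _)
      (submatrix_mem_unitaryGroup (Matrix.kronecker_mem_unitary hU (one_mem _)) _)
  · intro x e w x' w'
    rw [Matrix.mul_apply, Fintype.sum_prod_type]
    refine Finset.sum_congr rfl fun y _ => ?_
    rw [Fintype.sum_prod_type, Finset.sum_eq_single e, Finset.sum_eq_single w']
    · simp [isolate, hUK]
    · intro w'' _ h
      simp [h]
    · simp
    · intro e' _ h
      exact Finset.sum_eq_zero fun w'' _ => by simp [isolate, h.symm]
    · simp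

theorem discard_isolate_apply {X E W : Type*} [Fintype E] (M : Matrix (X × (E × W)) (X × (E × W)) ℂ)
    (a b : X × W) :
    discard (isolate X E W) M a b = ∑ e, M (a.1, (e, a.2)) (b.1, (e, b.2)) := rfl

theorem discard_isolate_ampliate {X Y E W : Type*} [Fintype E]
    (Φ : Matrix X X ℂ →ₗ[ℂ] Matrix Y Y ℂ) (M : Matrix (X × (E × W)) (X × (E × W)) ℂ) :
    discard (isolate Y E W) (ampliate Φ (E × W) M) =
      ampliate Φ W (discard (isolate X E W) M) := by
  ext a b
  have h : (Matrix.of fun x x' => discard (isolate X E W) M (x, a.2) (x', b.2)) =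
      ∑ e, Matrix.of fun x x' => M (x, (e, a.2)) (x', (e, b.2)) := by
    ext x x'
    simp [discard_isolate_apply, Matrix.sum_apply]
  rw [ampliate_apply, h, map_sum, Matrix.sum_apply]
  rfl

theorem discard_isolate_kronecker_traceFst {X Y E W : Type*} [Fintype E] [Fintype X]
    (P : Matrix Y Y ℂ) (M : Matrix (X × (E × W)) (X × (E × W)) ℂ) :
    discard (isolate Y E W) (P ⊗ₖ traceFst M) =
      P ⊗ₖ traceFst (discard (isolate X E W) M) := by
  ext a b
  simp only [discard_isolate_apply, Matrix.kroneckerMap_apply, traceFst, Matrix.of_apply,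
    Finset.mul_sum]
  exact Finset.sum_comm

end Dilation

/-! ### A channel on the initial region before the coupling -/

section ChannelBefore

variable {A Abar B Bbar W ι : Type u}
  [Fintype A] [DecidableEq A] [Fintype Abar] [DecidableEq Abar]
  [Fintype B] [DecidableEq B] [Fintype Bbar] [DecidableEq Bbar]
  [Fintype W] [DecidableEq W] [Fintype ι] [DecidableEq ι] {N : ℕ}

theorem extendCoupling_mul_tensorProd_apply
    (V : Matrix ((Fin N → A) × W) ((Fin N → A) × W) ℂ) (K : Fin N → Matrix A A ℂ)
    (a b : (Fin N → A × Abar) × W) :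
    (extendCoupling Abar V *
      ((tensorProd fun t => K t ⊗ₖ (1 : Matrix Abar Abar ℂ)) ⊗ₖ (1 : Matrix W W ℂ))) a b =
      (∑ y, V (fun t => (a.1 t).1, a.2) (y, b.2) * tensorProd K y (fun t => (b.1 t).1)) *
        if (fun t => (a.1 t).2) = (fun t => (b.1 t).2) then 1 else 0 := by
  have hL : ∀ k l : Fin N → A × Abar,
      (tensorProd fun t => K t ⊗ₖ (1 : Matrix Abar Abar ℂ)) k l =
        tensorProd K (fun t => (k t).1) (fun t => (l t).1) *
          if (fun t => (k t).2) = (fun t => (l t).2) then 1 else 0 := by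
    intro k l
    simp only [tensorProd_apply, Matrix.kroneckerMap_apply, Finset.prod_mul_distrib,
      Matrix.one_apply, Fintype.prod_ite_zero, Finset.prod_const_one, funext_iff]
  rw [Matrix.mul_apply, ← (regroup A Abar W N).symm.sum_comp, Fintype.sum_prod_type,
    Fintype.sum_prod_type, Finset.sum_mul]
  refine Finset.sum_congr rfl fun y _ => ?_
  rw [Finset.sum_eq_single b.2, Finset.sum_eq_single fun t => (a.1 t).2]
  · simp [extendCoupling, regroup, hL]
  · intro z _ hz
    simp [extendCoupling, regroup, hz.symm]
  · simp
  · intro w _ hw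
    exact Finset.sum_eq_zero fun z _ => by simp [regroup, hw]
  · simp

/-- A channel acting on `A^N` before the coupling `V` can be absorbed into a coupling to a larger
ancilla, part of which is then discarded. -/
theorem discard_coupledState (K : ι → Matrix A A ℂ) (e₀ : Fin N → ι) (ψ : W → ℂ)
    (ρ : Matrix (A × Abar) (A × Abar) ℂ)
    (V : Matrix ((Fin N → A) × W) ((Fin N → A) × W) ℂ)
    (V' : Matrix ((Fin N → A) × ((Fin N → ι) × W)) ((Fin N → A) × ((Fin N → ι) × W)) ℂ)
    (hV' : ∀ x e w x' w', V' (x, (e, w)) (x', (e₀, w')) =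
      ∑ y, V (x, w) (y, w') * tensorProd (fun t => K (e t)) y x') :
    discard (isolate _ (Fin N → ι) W)
        (coupledState N ρ (fun a : (Fin N → ι) × W => if a.1 = e₀ then ψ a.2 else 0) V') =
      coupledState N (ampliate (krausMap K) Abar ρ) ψ V := by
  let L : (Fin N → ι) → Matrix (Fin N → A × Abar) (Fin N → A × Abar) ℂ :=
    fun e => tensorProd fun t => K (e t) ⊗ₖ (1 : Matrix Abar Abar ℂ)
  -- Finding the environment in `e` means that the Kraus string `L e` acted before `V`. Only `e₀`
  -- survives in the inner sums because the environment starts there; summing the blocks over `e`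
  -- restores the channel.
  have hblock : ∀ e : Fin N → ι,
      (coupledState N ρ (fun a : (Fin N → ι) × W => if a.1 = e₀ then ψ a.2 else 0) V').submatrix
        (fun a : (Fin N → A × Abar) × W => (a.1, (e, a.2))) (fun a => (a.1, (e, a.2))) =
      (extendCoupling Abar V * (L e ⊗ₖ (1 : Matrix W W ℂ))) *
        (tensorPow N ρ ⊗ₖ Matrix.vecMulVec ψ (star ψ)) *
        (extendCoupling Abar V * (L e ⊗ₖ (1 : Matrix W W ℂ)))ᴴ := by
    intro e
    have hT : ∀ a b : (Fin N → A × Abar) × W,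
        extendCoupling Abar V' (a.1, (e, a.2)) (b.1, (e₀, b.2)) =
          (extendCoupling Abar V * (L e ⊗ₖ (1 : Matrix W W ℂ))) a b := by
      intro a b
      rw [extendCoupling_mul_tensorProd_apply]
      simp [extendCoupling, hV']
    have hsum : ∀ f : (Fin N → A × Abar) × ((Fin N → ι) × W) → ℂ,
        (∀ i e' w, e' ≠ e₀ → f (i, (e', w)) = 0) →
        ∑ a, f a = ∑ a : (Fin N → A × Abar) × W, f (a.1, (e₀, a.2)) := by
      intro f hf
      rw [Fintype.sum_prod_type, Fintype.sum_prod_type]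
      refine Finset.sum_congr rfl fun i _ => ?_
      rw [Fintype.sum_prod_type, Finset.sum_eq_single e₀]
      · exact fun e' _ he' => Finset.sum_eq_zero fun w _ => hf i e' w he'
      · simp
    ext a b
    rw [Matrix.submatrix_apply, coupledState, Matrix.mul_apply, Matrix.mul_apply, hsum]
    · refine Finset.sum_congr rfl fun c _ => ?_
      rw [Matrix.conjTranspose_apply, Matrix.conjTranspose_apply, hT, Matrix.mul_apply,
        Matrix.mul_apply, hsum]
      · congr 1
        refine Finset.sum_congr rfl fun d _ => ?_
        rw [hT]
        simp [Matrix.vecMulVec_apply]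
      · intro i e' w he'
        simp [Matrix.vecMulVec_apply, he']
    · intro i e' w he'
      rw [Matrix.mul_apply, Finset.sum_eq_zero, zero_mul]
      intro c _
      simp [Matrix.vecMulVec_apply, he']
  have hρ : ∑ e, L e * tensorPow N ρ * (L e)ᴴ = tensorPow N (ampliate (krausMap K) Abar ρ) := by
    rw [ampliate_krausMap, ← mapPow_tensorPow, mapPow_krausMap]
    rfl
  have hkron : ∀ e, (extendCoupling Abar V * (L e ⊗ₖ (1 : Matrix W W ℂ))) *
        (tensorPow N ρ ⊗ₖ Matrix.vecMulVec ψ (star ψ)) *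
        (extendCoupling Abar V * (L e ⊗ₖ (1 : Matrix W W ℂ)))ᴴ =
      extendCoupling Abar V * ((L e * tensorPow N ρ * (L e)ᴴ) ⊗ₖ Matrix.vecMulVec ψ (star ψ)) *
        (extendCoupling Abar V)ᴴ := by
    intro e
    have : (L e * tensorPow N ρ * (L e)ᴴ) ⊗ₖ Matrix.vecMulVec ψ (star ψ) =
        (L e ⊗ₖ (1 : Matrix W W ℂ)) * (tensorPow N ρ ⊗ₖ Matrix.vecMulVec ψ (star ψ)) *
          (L e ⊗ₖ (1 : Matrix W W ℂ))ᴴ := by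
      rw [Matrix.conjTranspose_kronecker, ← Matrix.mul_kronecker_mul, ← Matrix.mul_kronecker_mul,
        Matrix.conjTranspose_one, Matrix.one_mul, Matrix.mul_one]
    rw [this, Matrix.conjTranspose_mul]
    simp only [Matrix.mul_assoc]
  have hsumk : (∑ e, L e * tensorPow N ρ * (L e)ᴴ) ⊗ₖ Matrix.vecMulVec ψ (star ψ) =
      ∑ e, (L e * tensorPow N ρ * (L e)ᴴ) ⊗ₖ Matrix.vecMulVec ψ (star ψ) := by
    ext a b
    simp only [Matrix.sum_apply, Matrix.kroneckerMap_apply, Finset.sum_mul]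
  rw [coupledState.eq_def N (ampliate (krausMap K) Abar ρ), ← hρ, hsumk, Matrix.mul_sum,
    Matrix.sum_mul]
  ext a b
  rw [discard_isolate_apply, Matrix.sum_apply]
  refine Finset.sum_congr rfl fun e _ => ?_
  rw [← hkron, ← hblock]
  rfl

/-- A probe of the state after the channel is a probe of `ρ` by the ancilla enlarged with the
dilation's environment, followed by discarding that environment. Discarding respects the product
form of the reference, so data processing applies; keeping `τ` fixed is essential here. -/
theorem probeSup_ampliate_le {ρ : Matrix (A × Abar) (A × Abar) ℂ} (hρ : IsState ρ)
    {τ : Matrix B B ℂ} (hτ : τ.PosSemidef)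
    {𝓔 : Matrix (A × Abar) (A × Abar) ℂ →ₗ[ℂ] Matrix (B × Bbar) (B × Bbar) ℂ}
    (h𝓔 : IsKraus (evolveTo 𝓔)) {Φ : Matrix A A ℂ →ₗ[ℂ] Matrix A A ℂ} (hΦ : IsKraus Φ) (N : ℕ) :
    probeSup N (ampliate Φ Abar ρ) τ 𝓔 ≤ probeSup N ρ τ 𝓔 := by
  classical
  refine probeSup_le fun W _ _ ψ hψ V => ?_
  obtain ⟨ι, _, K, rfl, hK⟩ := hΦ
  -- Trace one excludes the zero-dimensional space, so an empty Kraus family could not satisfy the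
  -- completeness relation; this provides an initial state `e₀` of the environment.
  have hA : Nonempty A := by
    by_contra h
    rw [not_nonempty_iff] at h
    have := hρ.2
    simp [Matrix.trace] at this
  have hι : Nonempty ι := by
    by_contra h
    rw [not_nonempty_iff] at h
    simp at hK
  let e₀ : Fin N → ι := fun _ => Classical.arbitrary ι
  obtain ⟨V', hV', hVK⟩ := exists_unitary_dilation (fun e : Fin N → ι => tensorProd fun t => K (e t))
    (sum_tensorProd_star_mul K hK) e₀ V.2
  let ψ' : (Fin N → ι) × W → ℂ := fun a => if a.1 = e₀ then ψ a.2 else 0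
  have hψ' : ∑ a, ‖ψ' a‖ ^ 2 = 1 := by
    rw [Fintype.sum_prod_type, Finset.sum_eq_single e₀]
    · simpa [ψ'] using hψ
    · intro e _ he
      simp [ψ', he]
    · simp
  have hc : discard (isolate _ (Fin N → ι) W) (connectedState N ρ 𝓔 ψ' V') =
      connectedState N (ampliate (krausMap K) Abar ρ) 𝓔 ψ V.1 := by
    rw [connectedState, discard_isolate_ampliate, discard_coupledState K e₀ ψ ρ V.1 V' hVK]
    rfl
  refine le_trans ?_ (probeEntropy_le_probeSup N ρ τ 𝓔 hψ' ⟨V', hV'⟩)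
  have hpos := connectedState_posSemidef (N := N) hρ.1 h𝓔 ψ' V'
  rw [probeEntropy, probeEntropy, ← hc, ← discard_isolate_kronecker_traceFst]
  exact (isKraus_discard _).relEntropy_le hpos
    ((tensorPow_posSemidef hτ).kronecker (traceFst_posSemidef hpos))

end ChannelBefore

/-! ### Tensor products and nonnegativity of relative entropy -/

section Additivity

variable {X Y : Type u} [Fintype X] [DecidableEq X] [Fintype Y] [DecidableEq Y]

theorem Diagonalizes.kronecker {ρ U : Matrix X X ℂ} {p : X → ℝ} {ρ' U' : Matrix Y Y ℂ}
    {p' : Y → ℝ} (h : Diagonalizes ρ U p) (h' : Diagonalizes ρ' U' p') :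
    Diagonalizes (ρ ⊗ₖ ρ') (U ⊗ₖ U') (fun a => p a.1 * p' a.2) where
  mul_star := by
    rw [Matrix.conjTranspose_kronecker, ← Matrix.mul_kronecker_mul, h.mul_star, h'.mul_star,
      Matrix.one_kronecker_one]
  star_mul := by
    rw [Matrix.conjTranspose_kronecker, ← Matrix.mul_kronecker_mul, h.star_mul, h'.star_mul,
      Matrix.one_kronecker_one]
  eq := by
    have : Matrix.diagonal (fun a : X × Y => ((p a.1 * p' a.2 : ℝ) : ℂ)) =
        Matrix.diagonal (fun i => (p i : ℂ)) ⊗ₖ Matrix.diagonal (fun i => (p' i : ℂ)) := by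
      rw [Matrix.diagonal_kronecker_diagonal]
      simp
    rw [this, Matrix.conjTranspose_kronecker, ← Matrix.mul_kronecker_mul,
      ← Matrix.mul_kronecker_mul, ← h.eq, ← h'.eq]
  nonneg a := mul_nonneg (h.nonneg a.1) (h'.nonneg a.2)

theorem kronecker_mulVec_mul (M : Matrix X X ℂ) (M' : Matrix Y Y ℂ) (v : X → ℂ) (v' : Y → ℂ) :
    (M ⊗ₖ M') *ᵥ (fun a => v a.1 * v' a.2) = fun a => (M *ᵥ v) a.1 * (M' *ᵥ v') a.2 := by
  ext a
  simp only [Matrix.mulVec, dotProduct, Fintype.sum_prod_type, Finset.sum_mul_sum,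
    Matrix.kroneckerMap_apply]
  refine Finset.sum_congr rfl fun i _ => Finset.sum_congr rfl fun j _ => ?_
  ring

theorem IsState.exists_mulVec_ne_zero {ρ : Matrix X X ℂ} (h : IsState ρ) :
    ∃ (v : X → ℂ) (x : X), (ρ *ᵥ v) x ≠ 0 := by
  by_contra! hc
  have h0 : ρ = 0 := by
    ext i j
    have := hc (Pi.single j 1) i
    rwa [Matrix.mulVec_single_one] at this
  have := h.2
  simp [h0] at this

/-- The relative entropy is (super)additive on tensor products of states. -/
theorem add_relEntropy_le_relEntropy_kronecker {ρ σ : Matrix X X ℂ} {ρ' σ' : Matrix Y Y ℂ}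
    (hρ : IsState ρ) (hσ : σ.PosSemidef) (hρ' : IsState ρ') (hσ' : σ'.PosSemidef) :
    relEntropy ρ σ + relEntropy ρ' σ' ≤ relEntropy (ρ ⊗ₖ ρ') (σ ⊗ₖ σ') := by
  by_cases hs : ∀ v : X × Y → ℂ, (σ ⊗ₖ σ') *ᵥ v = 0 → (ρ ⊗ₖ ρ') *ᵥ v = 0
  swap
  · rw [relEntropy.eq_def (ρ ⊗ₖ ρ'), if_neg hs]
    exact le_top
  -- Test the joint support condition on a product vector whose second factor is not killed by `ρ'`;
  -- it exists since `ρ'` has trace one.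
  have hs1 : ∀ v : X → ℂ, σ *ᵥ v = 0 → ρ *ᵥ v = 0 := by
    intro v hv
    obtain ⟨v', y, hy⟩ := hρ'.exists_mulVec_ne_zero
    have h1 := hs (fun a => v a.1 * v' a.2) (by
      rw [kronecker_mulVec_mul, hv]
      ext a
      simp)
    rw [kronecker_mulVec_mul] at h1
    ext x
    simpa [hy] using congrFun h1 (x, y)
  have hs2 : ∀ v : Y → ℂ, σ' *ᵥ v = 0 → ρ' *ᵥ v = 0 := by
    intro v hv
    obtain ⟨v', x, hx⟩ := hρ.exists_mulVec_ne_zero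
    have h1 := hs (fun a => v' a.1 * v a.2) (by
      rw [kronecker_mulVec_mul, hv]
      ext a
      simp)
    rw [kronecker_mulVec_mul] at h1
    ext y
    simpa [hx] using congrFun h1 (x, y)
  rw [relEntropy, relEntropy, relEntropy, if_pos hs, if_pos hs1, if_pos hs2, ← EReal.coe_add,
    EReal.coe_le_coe_iff]
  obtain ⟨U, p, hU⟩ := exists_diagonalizes hρ.1
  obtain ⟨V, q, hV⟩ := exists_diagonalizes hσ
  obtain ⟨U', p', hU'⟩ := exists_diagonalizes hρ'.1
  obtain ⟨V', q', hV'⟩ := exists_diagonalizes hσ'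
  have t1 : ∑ i, ∑ j, ‖(Uᴴ * V) i j‖ ^ 2 * p i = 1 := by
    rw [← hU.trace_re_eq_sum hV, hρ.2, Complex.one_re]
  have t2 : ∑ i, ∑ j, ‖(U'ᴴ * V') i j‖ ^ 2 * p' i = 1 := by
    rw [← hU'.trace_re_eq_sum hV', hρ'.2, Complex.one_re]
  rw [hU.trace_mul_log_sub_log hV, hU'.trace_mul_log_sub_log hV',
    (hU.kronecker hU').trace_mul_log_sub_log (hV.kronecker hV')]
  have k1 := (hU.ker_le_iff hV).1 hs1
  have k2 := (hU'.ker_le_iff hV').1 hs2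
  have hC : (U ⊗ₖ U')ᴴ * (V ⊗ₖ V') = (Uᴴ * V) ⊗ₖ (U'ᴴ * V') := by
    rw [Matrix.conjTranspose_kronecker, ← Matrix.mul_kronecker_mul]
  rw [hC]
  -- The logarithm of a product splits only for nonzero factors. Zero `p`, `p'` or overlaps
  -- annihilate the term, and otherwise the support conditions force `q` and `q'` to be nonzero. The
  -- cross weights then sum to 1 by `t1` and `t2`.
  have hterm : ∀ (i j : X × Y),
      ‖((Uᴴ * V) ⊗ₖ (U'ᴴ * V')) i j‖ ^ 2 * ((p i.1 * p' i.2) *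
        (Real.log (p i.1 * p' i.2) - Real.log (q j.1 * q' j.2))) =
      (‖(Uᴴ * V) i.1 j.1‖ ^ 2 * (p i.1 * (Real.log (p i.1) - Real.log (q j.1)))) *
        (‖(U'ᴴ * V') i.2 j.2‖ ^ 2 * p' i.2) +
      (‖(Uᴴ * V) i.1 j.1‖ ^ 2 * p i.1) *
        (‖(U'ᴴ * V') i.2 j.2‖ ^ 2 * (p' i.2 * (Real.log (p' i.2) - Real.log (q' j.2)))) := by
    rintro ⟨i, i'⟩ ⟨j, j'⟩
    simp only [Matrix.kroneckerMap_apply, norm_mul, mul_pow]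
    have k1 := k1 i j
    have k2 := k2 i' j'
    generalize (Uᴴ * V) i j = c at *
    generalize (U'ᴴ * V') i' j' = c' at *
    by_cases h1 : p i = 0
    · simp [h1]
    by_cases h2 : p' i' = 0
    · simp [h2]
    by_cases h3 : c = 0
    · simp [h3]
    by_cases h4 : c' = 0
    · simp [h4]
    have h5 : q j ≠ 0 := fun h => by simpa [h1, h3] using k1 h
    have h6 : q' j' ≠ 0 := fun h => by simpa [h2, h4] using k2 h
    rw [Real.log_mul h1 h2, Real.log_mul h5 h6]
    ring
  have hprod : ∀ (f : X → X → ℝ) (g : Y → Y → ℝ),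
      ∑ i : X × Y, ∑ j : X × Y, f i.1 j.1 * g i.2 j.2 =
        (∑ i, ∑ j, f i j) * ∑ i, ∑ j, g i j := by
    intro f g
    simp only [Fintype.sum_prod_type, Finset.sum_mul_sum]
  simp only [hterm, Finset.sum_add_distrib]
  rw [hprod (fun i j => ‖(Uᴴ * V) i j‖ ^ 2 * (p i * (Real.log (p i) - Real.log (q j))))
      (fun i j => ‖(U'ᴴ * V') i j‖ ^ 2 * p' i),
    hprod (fun i j => ‖(Uᴴ * V) i j‖ ^ 2 * p i)
      (fun i j => ‖(U'ᴴ * V') i j‖ ^ 2 * (p' i * (Real.log (p' i) - Real.log (q' j)))),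
    t1, t2, mul_one, one_mul]

theorem relEntropy_self (ρ : Matrix X X ℂ) : relEntropy ρ ρ = 0 := by
  rw [relEntropy, if_pos fun _ h => h]
  simp

/-- Data processing for the full trace, which sends both states to the same one-dimensional state.
-/
theorem relEntropy_nonneg {ρ σ : Matrix X X ℂ} (hρ : IsState ρ) (hσ : IsState σ) :
    0 ≤ relEntropy ρ σ := by
  have h := (isKraus_discard (Equiv.punitProd X : PUnit.{u + 1} × X ≃ X)).relEntropy_le hρ.1 hσ.1
  have h1 : ∀ M : Matrix X X ℂ, IsState M →
      discard (Equiv.punitProd X : PUnit.{u + 1} × X ≃ X) M = 1 := by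
    intro M hM
    ext a b
    rw [discard_apply, Subsingleton.elim a b, Matrix.one_apply_eq, ← hM.2]
    rfl
  rwa [h1 ρ hρ, h1 σ hσ, relEntropy_self] at h

end Additivity

/-! ### Independent probes and superadditivity -/

section Superadditivity

variable {N M : ℕ}

/-- Regrouping `X^{N+M} (W W')` as `(X^N W) (X^M W')`. -/
def splitEquiv (X W W' : Type*) (N M : ℕ) :
    (Fin (N + M) → X) × (W × W') ≃ ((Fin N → X) × W) × ((Fin M → X) × W') :=
  ((Fin.appendEquiv N M).symm.prodCongr (Equiv.refl _)).trans (Equiv.prodProdProdComm _ _ _ _)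

theorem splitEquiv_apply (X W W' : Type*) (a : (Fin (N + M) → X) × (W × W')) :
    splitEquiv X W W' N M a = ((fun t => a.1 (Fin.castAdd M t), a.2.1),
      (fun t => a.1 (Fin.natAdd N t), a.2.2)) := rfl

theorem funext_castAdd_natAdd_iff {X : Type*} {f g : Fin (N + M) → X} :
    f = g ↔ (fun t => f (Fin.castAdd M t)) = (fun t => g (Fin.castAdd M t)) ∧
      (fun t => f (Fin.natAdd N t)) = fun t => g (Fin.natAdd N t) := by
  refine ⟨fun h => by simp [h], fun h => funext fun t => ?_⟩
  refine Fin.addCases (fun s => congrFun h.1 s) (fun s => congrFun h.2 s) t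

variable {A Abar B Bbar W W' : Type u}
  [Fintype A] [DecidableEq A] [Fintype Abar] [DecidableEq Abar]
  [Fintype B] [DecidableEq B] [Fintype Bbar] [DecidableEq Bbar]
  [Fintype W] [DecidableEq W] [Fintype W'] [DecidableEq W']

theorem coupledState_add (ρ : Matrix (A × Abar) (A × Abar) ℂ) (ψ : W → ℂ) (ψ' : W' → ℂ)
    (V : Matrix ((Fin N → A) × W) ((Fin N → A) × W) ℂ)
    (V' : Matrix ((Fin M → A) × W') ((Fin M → A) × W') ℂ) :
    coupledState (N + M) ρ (fun a : W × W' => ψ a.1 * ψ' a.2)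
      ((V ⊗ₖ V').submatrix (splitEquiv A W W' N M) (splitEquiv A W W' N M)) =
    (coupledState N ρ ψ V ⊗ₖ coupledState M ρ ψ' V').submatrix
      (splitEquiv (A × Abar) W W' N M) (splitEquiv (A × Abar) W W' N M) := by
  have h1 : extendCoupling Abar
      ((V ⊗ₖ V').submatrix (splitEquiv A W W' N M) (splitEquiv A W W' N M)) =
      (extendCoupling Abar V ⊗ₖ extendCoupling Abar V').submatrix
        (splitEquiv (A × Abar) W W' N M) (splitEquiv (A × Abar) W W' N M) := by
    ext a b
    simp only [extendCoupling, Matrix.of_apply, Matrix.submatrix_apply, splitEquiv_apply,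
      Matrix.kroneckerMap_apply]
    simp only [funext_castAdd_natAdd_iff (f := fun t => (a.1 t).2), ite_and]
    split_ifs <;> simp
  have h2 : tensorPow (N + M) ρ ⊗ₖ Matrix.vecMulVec (fun a : W × W' => ψ a.1 * ψ' a.2)
        (star fun a : W × W' => ψ a.1 * ψ' a.2) =
      ((tensorPow N ρ ⊗ₖ Matrix.vecMulVec ψ (star ψ)) ⊗ₖ
        (tensorPow M ρ ⊗ₖ Matrix.vecMulVec ψ' (star ψ'))).submatrix
        (splitEquiv (A × Abar) W W' N M) (splitEquiv (A × Abar) W W' N M) := by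
    ext a b
    simp only [tensorPow, Matrix.of_apply, Matrix.submatrix_apply, splitEquiv_apply,
      Matrix.kroneckerMap_apply, Matrix.vecMulVec_apply, Pi.star_apply, star_mul',
      Fin.prod_univ_add]
    ring
  rw [coupledState, h1, h2, Matrix.conjTranspose_submatrix, Matrix.submatrix_mul_equiv,
    Matrix.submatrix_mul_equiv, Matrix.conjTranspose_kronecker, ← Matrix.mul_kronecker_mul,
    ← Matrix.mul_kronecker_mul]
  rfl

theorem sum_fin_add {X : Type*} [Fintype X] {R : Type*} [AddCommMonoid R]
    (f : (Fin N → X) → (Fin M → X) → R) :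
    ∑ k : Fin (N + M) → X, f (fun t => k (Fin.castAdd M t)) (fun t => k (Fin.natAdd N t)) =
      ∑ k, ∑ l, f k l := by
  rw [← Fintype.sum_prod_type', ← (Fin.appendEquiv N M).symm.sum_comp]
  rfl

theorem sum_sum_fin_add_mul {X : Type*} [Fintype X] (f : (Fin N → X) → (Fin N → X) → ℂ)
    (g : (Fin M → X) → (Fin M → X) → ℂ) :
    ∑ k : Fin (N + M) → X, ∑ l : Fin (N + M) → X,
      f (fun t => k (Fin.castAdd M t)) (fun t => l (Fin.castAdd M t)) *
        g (fun t => k (Fin.natAdd N t)) (fun t => l (Fin.natAdd N t)) =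
      (∑ k, ∑ l, f k l) * ∑ k, ∑ l, g k l := by
  rw [sum_fin_add (fun k k' => ∑ l : Fin (N + M) → X,
    f k (fun t => l (Fin.castAdd M t)) * g k' (fun t => l (Fin.natAdd N t))), Finset.sum_mul_sum]
  refine Finset.sum_congr rfl fun k _ => Finset.sum_congr rfl fun k' _ => ?_
  rw [sum_fin_add (fun l l' => f k l * g k' l'), Finset.sum_mul_sum]

theorem ampliate_mapPow_add {X Y : Type u} [Fintype X] [DecidableEq X] [Fintype Y] [DecidableEq Y]
    (Φ : Matrix X X ℂ →ₗ[ℂ] Matrix Y Y ℂ)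
    (S : Matrix ((Fin N → X) × W) ((Fin N → X) × W) ℂ)
    (S' : Matrix ((Fin M → X) × W') ((Fin M → X) × W') ℂ) :
    ampliate (mapPow (N + M) Φ) (W × W')
      ((S ⊗ₖ S').submatrix (splitEquiv X W W' N M) (splitEquiv X W W' N M)) =
    (ampliate (mapPow N Φ) W S ⊗ₖ ampliate (mapPow M Φ) W' S').submatrix
      (splitEquiv Y W W' N M) (splitEquiv Y W W' N M) := by
  ext a b
  simp only [ampliate_apply, mapPow_apply, Matrix.of_apply, Matrix.submatrix_apply,
    splitEquiv_apply, Matrix.kroneckerMap_apply, Fin.prod_univ_add]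
  rw [← sum_sum_fin_add_mul]
  refine Finset.sum_congr rfl fun k _ => Finset.sum_congr rfl fun l _ => ?_
  ring

theorem connectedState_add (ρ : Matrix (A × Abar) (A × Abar) ℂ)
    (𝓔 : Matrix (A × Abar) (A × Abar) ℂ →ₗ[ℂ] Matrix (B × Bbar) (B × Bbar) ℂ)
    (ψ : W → ℂ) (ψ' : W' → ℂ)
    (V : Matrix ((Fin N → A) × W) ((Fin N → A) × W) ℂ)
    (V' : Matrix ((Fin M → A) × W') ((Fin M → A) × W') ℂ) :
    connectedState (N + M) ρ 𝓔 (fun a : W × W' => ψ a.1 * ψ' a.2)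
      ((V ⊗ₖ V').submatrix (splitEquiv A W W' N M) (splitEquiv A W W' N M)) =
    (connectedState N ρ 𝓔 ψ V ⊗ₖ connectedState M ρ 𝓔 ψ' V').submatrix
      (splitEquiv B W W' N M) (splitEquiv B W W' N M) := by
  rw [connectedState, coupledState_add, ampliate_mapPow_add]
  rfl

theorem tensorPow_add_kronecker_traceFst {Y : Type u} [Fintype Y] [DecidableEq Y] (τ : Matrix Y Y ℂ)
    (S : Matrix ((Fin N → Y) × W) ((Fin N → Y) × W) ℂ)
    (S' : Matrix ((Fin M → Y) × W') ((Fin M → Y) × W') ℂ) :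
    tensorPow (N + M) τ ⊗ₖ traceFst
      ((S ⊗ₖ S').submatrix (splitEquiv Y W W' N M) (splitEquiv Y W W' N M)) =
    ((tensorPow N τ ⊗ₖ traceFst S) ⊗ₖ (tensorPow M τ ⊗ₖ traceFst S')).submatrix
      (splitEquiv Y W W' N M) (splitEquiv Y W W' N M) := by
  ext a b
  have h : traceFst ((S ⊗ₖ S').submatrix (splitEquiv Y W W' N M) (splitEquiv Y W W' N M))
      a.2 b.2 = traceFst S a.2.1 b.2.1 * traceFst S' a.2.2 b.2.2 := by
    simp only [traceFst, Matrix.of_apply, Matrix.submatrix_apply, splitEquiv_apply,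
      Matrix.kroneckerMap_apply]
    rw [Finset.sum_mul_sum, ← sum_fin_add]
  simp only [Matrix.kroneckerMap_apply, h, Matrix.submatrix_apply, splitEquiv_apply, tensorPow,
    Matrix.of_apply, Fin.prod_univ_add]
  ring

/-- Probing the first `N` and the last `M` copies independently yields a product of the two joint
states and a product of the two references, on which relative entropy adds. Probes exceeding
arbitrary smaller values are used, since the suprema may be infinite or not attained. -/
theorem probeSup_add_le {ρ : Matrix (A × Abar) (A × Abar) ℂ} (hρ : IsState ρ)
    {τ : Matrix B B ℂ} (hτ : τ.PosSemidef)
    {𝓔 : Matrix (A × Abar) (A × Abar) ℂ →ₗ[ℂ] Matrix (B × Bbar) (B × Bbar) ℂ}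
    (h𝓔 : IsKraus (evolveTo 𝓔)) (N M : ℕ) :
    probeSup N ρ τ 𝓔 + probeSup M ρ τ 𝓔 ≤ probeSup (N + M) ρ τ 𝓔 := by
  refine EReal.add_le_of_forall_lt fun c hc c' hc' => ?_
  obtain ⟨W, _, _, ψ, hψ, V, hV⟩ := exists_lt_probeEntropy hc
  obtain ⟨W', _, _, ψ', hψ', V', hV'⟩ := exists_lt_probeEntropy hc'
  have hψψ : ∑ a : W × W', ‖ψ a.1 * ψ' a.2‖ ^ 2 = 1 := by
    simp only [norm_mul, mul_pow, Fintype.sum_prod_type]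
    rw [← Finset.sum_mul_sum, hψ, hψ', one_mul]
  refine (add_le_add hV.le hV'.le).trans (le_trans ?_ (probeEntropy_le_probeSup (N + M) ρ τ 𝓔 hψψ
    ⟨_, submatrix_mem_unitaryGroup (Matrix.kronecker_mem_unitary V.2 V'.2)
      (splitEquiv A W W' N M)⟩))
  have h1 := connectedState_isState (N := N) hρ h𝓔 hψ V.2
  have h2 := connectedState_isState (N := M) hρ h𝓔 hψ' V'.2
  have h3 := (tensorPow_posSemidef (N := N) hτ).kronecker (traceFst_posSemidef h1.1)
  have h4 := (tensorPow_posSemidef (N := M) hτ).kronecker (traceFst_posSemidef h2.1)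
  simp only [probeEntropy, connectedState_add]
  rw [tensorPow_add_kronecker_traceFst,
    relEntropy_submatrix _ (h1.1.kronecker h2.1) (h3.kronecker h4)]
  exact add_relEntropy_le_relEntropy_kronecker h1 h3 h2 h4

/-- The trivial coupling to a one-dimensional ancilla already compares two states. -/
theorem probeSup_nonneg {ρ : Matrix (A × Abar) (A × Abar) ℂ} (hρ : IsState ρ)
    {τ : Matrix B B ℂ} (hτ : IsState τ)
    {𝓔 : Matrix (A × Abar) (A × Abar) ℂ →ₗ[ℂ] Matrix (B × Bbar) (B × Bbar) ℂ}
    (h𝓔 : IsKraus (evolveTo 𝓔)) (N : ℕ) : 0 ≤ probeSup N ρ τ 𝓔 := by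
  have hψ : ∑ w : PUnit.{u + 1}, ‖(fun _ => 1 : PUnit.{u + 1} → ℂ) w‖ ^ 2 = 1 := by simp
  refine le_trans ?_ (probeEntropy_le_probeSup N ρ τ 𝓔 hψ 1)
  have h1 := connectedState_isState (N := N) hρ h𝓔 hψ
    (1 : Matrix.unitaryGroup ((Fin N → A) × PUnit.{u + 1}) ℂ).2
  refine relEntropy_nonneg h1 ⟨(tensorPow_posSemidef hτ.1).kronecker (traceFst_posSemidef h1.1), ?_⟩
  rw [Matrix.trace_kronecker, trace_tensorPow, hτ.2, trace_traceFst, h1.2, one_pow, one_mul]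

end Superadditivity

/-! ### Existence of the limit -/

section Limit

/-- Split off `q` blocks of length `m` and drop the nonnegative remainder. The real lower bound `y`
avoids arithmetic with `u m`, which may be infinite. -/
theorem mul_le_of_superadditive {u : ℕ → EReal} (hu : ∀ m n, u m + u n ≤ u (m + n))
    (h0 : ∀ n, 0 ≤ u n) {m : ℕ} {y : ℝ} (hy : (y : EReal) ≤ u m) (q r : ℕ) :
    ((q * y : ℝ) : EReal) ≤ u (q * m + r) := by
  induction q with
  | zero => simpa using h0 r
  | succ q ih =>
    have h1 : (q + 1) * m + r = m + (q * m + r) := by ring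
    have h2 : (((q + 1 : ℕ) : ℝ) * y : ℝ) = y + q * y := by push_cast; ring
    rw [h1, h2, EReal.coe_add]
    exact (add_le_add hy ih).trans (hu _ _)

theorem eventually_le_div_of_superadditive {u : ℕ → EReal} (hu : ∀ m n, u m + u n ≤ u (m + n))
    (h0 : ∀ n, 0 ≤ u n) {m : ℕ} (hm : 1 ≤ m) {c : EReal} (hc : c < u m / m) :
    ∀ᶠ n : ℕ in atTop, c ≤ u n / n := by
  have hnn : ∀ n : ℕ, 0 ≤ u n / n := fun n => EReal.div_nonneg (h0 n) (by positivity)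
  obtain ⟨c', hcc', hc'⟩ := EReal.lt_iff_exists_real_btwn.1 hc
  rcases lt_or_ge c' 0 with hneg | hpos
  · refine Eventually.of_forall fun n => hcc'.le.trans (le_trans ?_ (hnn n))
    exact_mod_cast hneg.le
  -- The gap between `c'` and `c''` pays for the incomplete last block: at least `n - m` of the `n`
  -- indices lie in complete blocks, and `c'' * (n - m) ≥ c' * n` once `(c'' - c') * n ≥ c'' * m`.
  obtain ⟨c'', hcc'', hc''⟩ := EReal.lt_iff_exists_real_btwn.1 hc'
  have hlt : c' < c'' := by exact_mod_cast hcc''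
  have hmpos : (0 : EReal) < m := by exact_mod_cast hm
  have hum : ((c'' * m : ℝ) : EReal) ≤ u m := by
    have := (EReal.lt_div_iff hmpos (EReal.natCast_ne_top m)).1 hc''
    rw [EReal.coe_mul]
    exact_mod_cast this.le
  have hlim : ∀ᶠ n : ℕ in atTop, c'' * m ≤ (c'' - c') * n := by
    have : Tendsto (fun n : ℕ => (c'' - c') * (n : ℝ)) atTop atTop :=
      Tendsto.const_mul_atTop (sub_pos.2 hlt) tendsto_natCast_atTop_atTop
    exact this.eventually_ge_atTop _
  filter_upwards [hlim, eventually_ge_atTop 1] with n hn hn1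
  have hnpos : (0 : EReal) < n := by exact_mod_cast hn1
  refine hcc'.le.trans ((EReal.le_div_iff_mul_le hnpos (EReal.natCast_ne_top n)).2 ?_)
  have h1 := mul_le_of_superadditive hu h0 hum (n / m) (n % m)
  rw [Nat.div_add_mod'] at h1
  refine le_trans ?_ h1
  have h2 : c' * n ≤ ((n / m : ℕ) : ℝ) * (c'' * m) := by
    have h3 : (n : ℝ) ≤ ((n / m : ℕ) : ℝ) * m + m := by
      have h4 := Nat.div_add_mod' n m
      have h5 := (Nat.mod_lt n hm).le
      exact_mod_cast (show n ≤ n / m * m + m by omega)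
    have h6 := mul_le_mul_of_nonneg_left h3 (hpos.trans hlt.le)
    nlinarith
  have h7 : ((c' * n : ℝ) : EReal) ≤ (((n / m : ℕ) : ℝ) * (c'' * m) : ℝ) := by exact_mod_cast h2
  rw [EReal.coe_mul] at h7
  exact_mod_cast h7

/-- **Fekete's lemma** for nonnegative superadditive sequences in the extended reals. -/
theorem tendsto_div_of_superadditive {u : ℕ → EReal} (hu : ∀ m n, u m + u n ≤ u (m + n))
    (h0 : ∀ n, 0 ≤ u n) :
    Tendsto (fun n : ℕ => u n / n) atTop (𝓝 (limsup (fun n : ℕ => u n / n) atTop)) := by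
  refine tendsto_of_le_liminf_of_limsup_le (le_of_forall_lt fun c hc => ?_) le_rfl
  obtain ⟨c', hcc', hc'⟩ := exists_between hc
  -- One good `m` below the upper limit suffices: its bound propagates to all large `n`, so the
  -- lower limit reaches the upper one.
  obtain ⟨m, hm, hm1⟩ := ((frequently_lt_of_lt_limsup (by isBoundedDefault) hc').and_eventually
    (eventually_ge_atTop 1)).exists
  exact hcc'.trans_le (le_liminf_of_le (by isBoundedDefault)
    (eventually_le_div_of_superadditive hu h0 hm1 hm))

/-- By definition the rate is `probeSup` divided by `N`. Letting `τ` be independent of `ρ` covers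
the case in which a channel has changed `ρ` but not the reference. -/
theorem tendsto_optimalRate {A Abar B Bbar : Type u}
    [Fintype A] [DecidableEq A] [Fintype Abar] [DecidableEq Abar]
    [Fintype B] [DecidableEq B] [Fintype Bbar] [DecidableEq Bbar]
    {ρ : Matrix (A × Abar) (A × Abar) ℂ} (hρ : IsState ρ) {τ : Matrix B B ℂ} (hτ : IsState τ)
    {𝓔 : Matrix (A × Abar) (A × Abar) ℂ →ₗ[ℂ] Matrix (B × Bbar) (B × Bbar) ℂ}
    (h𝓔 : IsKraus (evolveTo 𝓔)) :
    Tendsto (fun N => optimalRate N ρ τ 𝓔) atTop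
      (𝓝 (limsup (fun N => optimalRate N ρ τ 𝓔) atTop)) :=
  tendsto_div_of_superadditive (probeSup_add_le hρ hτ.1 h𝓔) (probeSup_nonneg hρ hτ h𝓔)

end Limit

end STMI

end

/-- Monotonicity of the space-time mutual information, for a finite-dimensional system with initial
state `ρ` and evolution `𝓔` (an arbitrary channel, in particular a unitary evolution). -/
theorem mainTheorem3 :
    -- the limits defining `J` exist, without and with a channel applied to `A`
    (∀ (A Abar B Bbar : Type u) [Fintype A] [DecidableEq A] [Fintype Abar] [DecidableEq Abar]
        [Fintype B] [DecidableEq B] [Fintype Bbar] [DecidableEq Bbar]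
        (ρ : Matrix (A × Abar) (A × Abar) ℂ)
        (𝓔 : Matrix (A × Abar) (A × Abar) ℂ →ₗ[ℂ] Matrix (B × Bbar) (B × Bbar) ℂ)
        (ΦA : Matrix A A ℂ →ₗ[ℂ] Matrix A A ℂ),
        STMI.IsState ρ → STMI.IsChannel 𝓔 → STMI.IsChannel ΦA →
        Tendsto (fun N => STMI.stmiN N ρ 𝓔) atTop (𝓝 (STMI.stmi ρ 𝓔)) ∧
        Tendsto (fun N => STMI.stmiNAfter N ΦA ρ 𝓔) atTop (𝓝 (STMI.stmiAfter ΦA ρ 𝓔))) ∧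
    -- a channel applied to `B`
    (∀ (A Abar B Bbar B' : Type u) [Fintype A] [DecidableEq A] [Fintype Abar] [DecidableEq Abar]
        [Fintype B] [DecidableEq B] [Fintype Bbar] [DecidableEq Bbar]
        [Fintype B'] [DecidableEq B']
        (ρ : Matrix (A × Abar) (A × Abar) ℂ)
        (𝓔 : Matrix (A × Abar) (A × Abar) ℂ →ₗ[ℂ] Matrix (B × Bbar) (B × Bbar) ℂ)
        (ΦB : Matrix B B ℂ →ₗ[ℂ] Matrix B' B' ℂ),
        STMI.IsState ρ → STMI.IsChannel 𝓔 → STMI.IsChannel ΦB →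
        (∀ N : ℕ, 1 ≤ N →
          STMI.stmiN N ρ (STMI.ampliate ΦB Bbar ∘ₗ 𝓔) ≤ STMI.stmiN N ρ 𝓔) ∧
        STMI.stmi ρ (STMI.ampliate ΦB Bbar ∘ₗ 𝓔) ≤ STMI.stmi ρ 𝓔) ∧
    -- a channel applied to `A`
    (∀ (A Abar B Bbar : Type u) [Fintype A] [DecidableEq A] [Fintype Abar] [DecidableEq Abar]
        [Fintype B] [DecidableEq B] [Fintype Bbar] [DecidableEq Bbar]
        (ρ : Matrix (A × Abar) (A × Abar) ℂ)
        (𝓔 : Matrix (A × Abar) (A × Abar) ℂ →ₗ[ℂ] Matrix (B × Bbar) (B × Bbar) ℂ)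
        (ΦA : Matrix A A ℂ →ₗ[ℂ] Matrix A A ℂ),
        STMI.IsState ρ → STMI.IsChannel 𝓔 → STMI.IsChannel ΦA →
        (∀ N : ℕ, 1 ≤ N → STMI.stmiNAfter N ΦA ρ 𝓔 ≤ STMI.stmiN N ρ 𝓔) ∧
        STMI.stmiAfter ΦA ρ 𝓔 ≤ STMI.stmi ρ 𝓔) ∧
    -- `J(A:B) ≤ J(AC:B)`, where `R` is the rest of the initial system
    (∀ (A C R B Bbar : Type u) [Fintype A] [DecidableEq A] [Fintype C] [DecidableEq C]
        [Fintype R] [DecidableEq R] [Fintype B] [DecidableEq B] [Fintype Bbar] [DecidableEq Bbar]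
        (ρ : Matrix ((A × C) × R) ((A × C) × R) ℂ)
        (𝓔 : Matrix ((A × C) × R) ((A × C) × R) ℂ →ₗ[ℂ] Matrix (B × Bbar) (B × Bbar) ℂ),
        STMI.IsState ρ → STMI.IsChannel 𝓔 →
        (∀ N : ℕ, 1 ≤ N →
          STMI.stmiN N (STMI.assoc A C R ρ) (𝓔 ∘ₗ (STMI.assoc A C R).symm.toLinearMap) ≤
            STMI.stmiN N ρ 𝓔) ∧
        STMI.stmi (STMI.assoc A C R ρ) (𝓔 ∘ₗ (STMI.assoc A C R).symm.toLinearMap) ≤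
          STMI.stmi ρ 𝓔) ∧
    -- `J(A:B) ≤ J(A:BD)`, where `R` is the rest of the final system
    (∀ (A Abar B D R : Type u) [Fintype A] [DecidableEq A] [Fintype Abar] [DecidableEq Abar]
        [Fintype B] [DecidableEq B] [Fintype D] [DecidableEq D] [Fintype R] [DecidableEq R]
        (ρ : Matrix (A × Abar) (A × Abar) ℂ)
        (𝓔 : Matrix (A × Abar) (A × Abar) ℂ →ₗ[ℂ] Matrix ((B × D) × R) ((B × D) × R) ℂ),
        STMI.IsState ρ → STMI.IsChannel 𝓔 →
        (∀ N : ℕ, 1 ≤ N →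
          STMI.stmiN N ρ ((STMI.assoc B D R).toLinearMap ∘ₗ 𝓔) ≤ STMI.stmiN N ρ 𝓔) ∧
        STMI.stmi ρ ((STMI.assoc B D R).toLinearMap ∘ₗ 𝓔) ≤ STMI.stmi ρ 𝓔) := by
  refine ⟨?_, ?_, ?_, ?_, ?_⟩
  · intro A Abar B Bbar _ _ _ _ _ _ _ _ ρ 𝓔 ΦA hρ h𝓔 hΦ
    have hE := h𝓔.isKraus_evolveTo
    exact ⟨STMI.tendsto_optimalRate hρ (hE.isState hρ) hE,
      STMI.tendsto_optimalRate (hΦ.isKraus.ampliate.isState hρ) (hE.isState hρ) hE⟩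
  · intro A Abar B Bbar B' _ _ _ _ _ _ _ _ _ _ ρ 𝓔 ΦB hρ h𝓔 hΦ
    have h := STMI.stmiN_le_of_evolveTo_eq_comp hρ.1 h𝓔.isKraus_evolveTo hΦ.isKraus
      (STMI.evolveTo_ampliate_comp 𝓔 ΦB)
    exact ⟨fun N _ => h N, limsup_le_limsup (Eventually.of_forall h)⟩
  · intro A Abar B Bbar _ _ _ _ _ _ _ _ ρ 𝓔 ΦA hρ h𝓔 hΦ
    have hE := h𝓔.isKraus_evolveTo
    have h : ∀ N, STMI.stmiNAfter N ΦA ρ 𝓔 ≤ STMI.stmiN N ρ 𝓔 := fun N =>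
      STMI.optimalRate_le_of_probeSup_le
        (STMI.probeSup_ampliate_le hρ (hE.posSemidef hρ.1) hE hΦ.isKraus N)
    exact ⟨fun N _ => h N, limsup_le_limsup (Eventually.of_forall h)⟩
  · intro A C R B Bbar _ _ _ _ _ _ _ _ _ _ ρ 𝓔 _ _
    have h := STMI.stmiN_assoc_le ρ 𝓔
    exact ⟨fun N _ => h N, limsup_le_limsup (Eventually.of_forall h)⟩
  · intro A Abar B D R _ _ _ _ _ _ _ _ _ _ ρ 𝓔 hρ h𝓔
    have h := STMI.stmiN_le_of_evolveTo_eq_comp hρ.1 h𝓔.isKraus_evolveTo STMI.isKraus_traceSnd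
      (STMI.evolveTo_assoc_comp 𝓔)
    exact ⟨fun N _ => h N, limsup_le_limsup (Eventually.of_forall h)⟩
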